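/- Let $K$ be a field, let $A=K[X_0,\dots,X_n]$ with its standard grading, so that $\mathbb P^n=\operatorname{Proj}A$, and let $V\subset\mathbb P^n$ be a closed subset with homogeneous ideal $I\subset A$ (the ideal of all polynomials vanishing on $V$). Suppose that $V$ is a set-theoretic complete intersection of codimension $r$, that is, $V$ has codimension $r$ in $\mathbb P^n$ and there are nonzero homogeneous polynomials $f_1,\dots,f_r\in A$ of positive degree such that $V$ is, as a set, the intersection of the hypersurfaces $f_1=0,\dots,f_r=0$. Then the local cohomology module $H^r_I(A)=\varinjlim_J\operatorname{Ext}^r_A(A/J,A)$ ($J$ running over the ideals with $I\subset\sqrt J$), with its natural $\mathbb Z$-grading, is a graded quasi-cyclic $A$-module: it is a graded $A$-module, and there are homogeneous elements $m_0,m_1,m_2,\dots$ of it such that $Am_0\subset Am_1\subset Am_2\subset\cdots$ and $H^r_I(A)=\bigcup_{s\ge 0}Am_s$. -/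

import Mathlib

open CategoryTheory

universe u

noncomputable section

namespace QuasiCyclic

/-! ### Graded modules -/

section Graded

variable {K : Type*} {R : Type u} [CommRing K] [CommRing R] [Algebra K R]

/-- The `ℕ`-grading `𝒜` of `R`, regarded as a `ℤ`-grading that vanishes in negative degrees. -/
def intDegree (𝒜 : ℕ → Submodule K R) (d : ℤ) : AddSubgroup R :=
  if 0 ≤ d then (𝒜 d.toNat).toAddSubgroup else ⊥

/-- The family `ℳ` of additive subgroups makes the `R`-module `M` a `ℤ`-graded module over the
graded ring `R`: `M` is the internal direct sum of the `ℳ d`, and `𝒜 i • ℳ d ⊆ ℳ (i + d)`. -/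
structure IsGradedModule (𝒜 : ℕ → Submodule K R) {M : Type*} [AddCommGroup M] [Module R M]
    (ℳ : ℤ → AddSubgroup M) : Prop where
  isInternal : DirectSum.IsInternal ℳ
  smul_mem : ∀ (i : ℕ) (d : ℤ) (a : R) (m : M), a ∈ 𝒜 i → m ∈ ℳ d → a • m ∈ ℳ (i + d)

/-- `M` with the grading `ℳ` is a graded quasi-cyclic module: it is a graded module, and it is the
union of a countable increasing chain of cyclic submodules generated by homogeneous elements. -/
structure IsGradedQuasiCyclic (𝒜 : ℕ → Submodule K R) {M : Type*} [AddCommGroup M] [Module R M]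
    (ℳ : ℤ → AddSubgroup M) : Prop where
  isGradedModule : IsGradedModule 𝒜 ℳ
  exists_chain : ∃ m : ℕ → M,
    (∀ s, ∃ d : ℤ, m s ∈ ℳ d) ∧
    Monotone (fun s => Submodule.span R {m s}) ∧
    ⋃ s, (Submodule.span R {m s} : Set M) = Set.univ

/-! ### The natural grading on local cohomology -/

/-- A graded projective resolution of `R ⧸ J`: a projective resolution whose terms are graded
modules and whose differentials and augmentation preserve degrees. -/
structure GradedResolution (𝒜 : ℕ → Submodule K R) (J : Ideal R) where
  res : ProjectiveResolution (ModuleCat.of R (R ⧸ J))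
  deg : ∀ i : ℕ, ℤ → AddSubgroup (res.complex.X i)
  isGradedModule : ∀ i, IsGradedModule 𝒜 (deg i)
  d_mem : ∀ (i j : ℕ) (e : ℤ) (m : res.complex.X i), m ∈ deg i e → res.complex.d i j m ∈ deg j e
  aug_mem : ∀ (e : ℤ) (m : res.complex.X 0), m ∈ deg 0 e →
    (res.π.f 0 ≫ (HomologicalComplex.singleObjXSelf (ComplexShape.down ℕ) 0
      (ModuleCat.of R (R ⧸ J))).hom) m ∈
      (intDegree 𝒜 e).map (Ideal.Quotient.mk J).toAddMonoidHom

/-- A class in `Ext^i(R ⧸ J, R)` is homogeneous of degree `e` if, on some graded projective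
resolution `P` of `R ⧸ J`, it is represented by a cocycle `φ : P_i ⟶ R` of degree `e`, that is,
one that maps the degree `j` part of `P_i` into the degree `j + e` part of `R`. -/
def IsHomogeneousExt (𝒜 : ℕ → Submodule K R) (J : Ideal R) (i : ℕ) (e : ℤ)
    (x : ((Ext R (ModuleCat.{u} R) i).obj (Opposite.op (ModuleCat.of R (R ⧸ J)))).obj
      (ModuleCat.of R R)) : Prop :=
  ∃ (P : GradedResolution 𝒜 J)
    (z : (P.res.complex.linearYonedaObj R (ModuleCat.of R R)).cycles i)
    (φ : P.res.complex.X i ⟶ ModuleCat.of R R),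
    (P.res.complex.linearYonedaObj R (ModuleCat.of R R)).iCycles i z = φ ∧
    (∀ (j : ℤ) (m : P.res.complex.X i), m ∈ P.deg i j → φ m ∈ intDegree 𝒜 (j + e)) ∧
    (P.res.isoExt i (ModuleCat.of R R)).hom x =
      (P.res.complex.linearYonedaObj R (ModuleCat.of R R)).homologyπ i z

/-- For an ideal `J` whose radical contains `I`, the natural map
`Ext^i(R ⧸ J, R) ⟶ H^i_I(R)`. -/
def extToLocalCohomology [IsNoetherianRing R] (I : Ideal R) (i : ℕ)
    (J : localCohomology.SelfLERadical I) :
    ((Ext R (ModuleCat.{u} R) i).obj (Opposite.op (ModuleCat.of R (R ⧸ J.obj)))).obj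
      (ModuleCat.of R R) ⟶ (localCohomology I i).obj (ModuleCat.of R R) :=
  have := localCohomology.hasColimitDiagram.{u, u} (localCohomology.selfLERadicalDiagram I) i
  (Limits.colimit.ι (localCohomology.diagram (localCohomology.selfLERadicalDiagram I) i)
      (Opposite.op J)).app (ModuleCat.of R R) ≫
    (localCohomology.isoSelfLERadical I i).hom.app (ModuleCat.of R R)

/-- The degree `e` part of `H^i_I(R) = colim_J Ext^i(R ⧸ J, R)`: it is generated by the images of
the homogeneous classes of degree `e` in `Ext^i(R ⧸ J, R)`, where `J` runs over the homogeneous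
ideals whose radical contains `I`. -/
def localCohomologyDegree [IsNoetherianRing R] (𝒜 : ℕ → Submodule K R) [GradedRing 𝒜]
    (I : Ideal R) (i : ℕ) (e : ℤ) :
    AddSubgroup ((localCohomology I i).obj (ModuleCat.of R R)) :=
  AddSubgroup.closure
    {y | ∃ J : localCohomology.SelfLERadical I, J.obj.IsHomogeneous 𝒜 ∧
      ∃ x, IsHomogeneousExt 𝒜 J.obj i e x ∧ extToLocalCohomology I i J x = y}

end Graded

/-! ### Subvarieties of projective space -/

section Projective

open MvPolynomial

/-- The standard grading of the homogeneous coordinate ring `K[X_0, …, X_n]` of `ℙ^n_K`. -/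
abbrev grading (K : Type u) [Field K] (n : ℕ) : ℕ → Submodule K (MvPolynomial (Fin (n + 1)) K) :=
  homogeneousSubmodule (Fin (n + 1)) K

instance (K : Type u) [Field K] (n : ℕ) : GradedRing (grading K n) :=
  MvPolynomial.gradedAlgebra

/-- The points of projective space `ℙ^n_K = Proj K[X_0, …, X_n]`, with the Zariski topology. -/
abbrev ProjSpace (K : Type u) [Field K] (n : ℕ) : Type u :=
  ProjectiveSpectrum (grading K n)

variable {K : Type u} [Field K] {n : ℕ}

/-- The codimension of a closed subset of `ℙ^n`: the infimum over its points `x` of the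
codimension of the closure of `x`, which is the supremum of the lengths of chains
`x_0 < ⋯ < x_m = x` of relevant homogeneous primes (equivalently, of chains of irreducible closed
subsets that start with the closure of `x`). The empty set has codimension `⊤`. -/
def codim (V : Set (ProjSpace K n)) : ℕ∞ :=
  ⨅ x ∈ V, Order.height x

/-- `V` has codimension `r` and is the intersection of `r` hypersurfaces. -/
structure IsSetTheoreticCompleteIntersection (V : Set (ProjSpace K n)) (r : ℕ) : Prop where
  codim_eq : codim V = r
  exists_hypersurfaces : ∃ f : Fin r → MvPolynomial (Fin (n + 1)) K,
    (∀ i, f i ≠ 0 ∧ ∃ d, 0 < d ∧ (f i).IsHomogeneous d) ∧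
    V = ⋂ i, ProjectiveSpectrum.zeroLocus (grading K n) {f i}

/-- The homogeneous ideal of `V`: all polynomials that vanish on `V`. -/
def idealOf (V : Set (ProjSpace K n)) : Ideal (MvPolynomial (Fin (n + 1)) K) :=
  (ProjectiveSpectrum.vanishingIdeal V).toIdeal

end Projective

end QuasiCyclic

end

/-! Put `J s = (f₁^s, …, f_r^s)`. Since `V` is nonempty and cut out by the `f_j`, its ideal `I` lies
in the radical of `(f₁, …, f_r)` (`idealOf_le_radical_span`). Hence the homogeneous ideals `J s`
form a decreasing sequence, cofinal among the ideals whose radical contains `I`, and `H^r_I(A)` can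
be computed along it.

The Koszul complexes of the `f_j^s` are not assumed to be resolutions. It suffices that their
positive-degree homology is pro-zero in `s`, which follows from the Noetherian property by adding
one element at a time (`cone_prozero`). Two comparisons of complexes result. The `s`-th Koszul
complex, being projective, maps to any resolution of `A ⧸ L` with `J s ≤ L`. Conversely, for some `t
≥ s`, every graded resolution of `A ⧸ J t` maps in degree zero to the `s`-th Koszul complex
(`exists_gradedChainMap_from_resolution`).

The composite lifts the projection `A ⧸ J t → A ⧸ L`, so it computes restriction of `Ext` classes
from `L` to `J t`. In degree `r` it passes through the last Koszul module, which is free of rank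
one. Thus every class on such an `L` becomes a multiple of one homogeneous class `m`, namely that of
the Koszul coordinate pulled back to the resolution of `A ⧸ J t` (`exists_homogeneous_generator`).
Since `m` itself lives on `J t`, it is a multiple of the class constructed from any later index, and
iterating gives the chain of cyclic submodules.

For the grading, sums of homogeneous classes are compared on a common graded resolution. If such a
sum is a coboundary, taking degree parts of the bounding cochain shows that each term is one too
(`localCohomologyDegree_independent`). The homogeneous parts span because every element is a
multiple of a homogeneous one. -/

noncomputable section

namespace QuasiCyclic

/-! ### Ext classes represented by cocycles on projective resolutions -/

section ExtClasses

open HomologicalComplex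

variable {R : Type u} [CommRing R]

/-- The map on `Hom`-complexes induced by a chain map. -/
def linearYonedaObjMap {C D : ChainComplex (ModuleCat.{u} R) ℕ} (κ : C ⟶ D)
    (Y : ModuleCat.{u} R) : D.linearYonedaObj R Y ⟶ C.linearYonedaObj R Y where
  f i := ((linearYoneda R (ModuleCat.{u} R)).obj Y).map (κ.f i).op
  comm' i j _ := by
    refine ModuleCat.hom_ext (LinearMap.ext fun φ => ?_)
    exact ((Category.assoc _ _ φ).symm.trans
      (congrArg (· ≫ φ) (κ.comm j i).symm)).trans (Category.assoc _ _ φ)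

lemma comp_square_of_comp_iso_square {C : Type*} [Category C] {A B D D' E F : C}
    {m : A ⟶ B} {p : B ⟶ D} {q : D' ≅ D} {p' : A ⟶ E} {n : E ⟶ D} {q' : F ≅ E} {l : F ⟶ D'}
    (h₁ : m ≫ p = p' ≫ n) (h₂ : q'.hom ≫ n = l ≫ q.hom) :
    m ≫ p ≫ q.inv = (p' ≫ q'.inv) ≫ l := by
  rw [← Category.assoc, h₁, Category.assoc, Category.assoc]
  congr 1
  rw [Iso.comp_inv_eq, Category.assoc, ← h₂, Iso.inv_hom_id_assoc]

/-- `Ext` is the opposite of a left derived functor into the opposite category. Naturality is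
therefore that of the left derived functor, pasted after `unop` with the naturality of the homology
of opposite complexes. -/
lemma isoExt_hom_naturality {X X' : ModuleCat.{u} R} (f : X' ⟶ X)
    (P : ProjectiveResolution X) (P' : ProjectiveResolution X')
    (κ : P'.complex ⟶ P.complex) (comm : κ.f 0 ≫ P.π.f 0 = P'.π.f 0 ≫ f) (n : ℕ)
    (Y : ModuleCat.{u} R) :
    ((Ext R (ModuleCat.{u} R) n).map f.op).app Y ≫ (P'.isoExt n Y).hom =
      (P.isoExt n Y).hom ≫ homologyMap (linearYonedaObjMap κ Y) n := by
  have h1 := congrArg Quiver.Hom.unop (P'.isoLeftDerivedObj_inv_naturality f P κ comm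
    ((linearYoneda R (ModuleCat.{u} R)).obj Y).rightOp n)
  have h2 := congrArg Quiver.Hom.unop (homologyOp_hom_naturality (linearYonedaObjMap κ Y) n)
  exact comp_square_of_comp_iso_square h1 h2

/-- The class `x` in `Ext^i(X, Y)` is represented by the cocycle `φ : P_i ⟶ Y`. -/
def Represents {X Y : ModuleCat.{u} R} (P : ProjectiveResolution X) (i : ℕ)
    (φ : P.complex.X i ⟶ Y)
    (x : ((Ext R (ModuleCat.{u} R) i).obj (Opposite.op X)).obj Y) : Prop :=
  ∃ z : (P.complex.linearYonedaObj R Y).cycles i,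
    (P.complex.linearYonedaObj R Y).iCycles i z = φ ∧
    (P.isoExt i Y).hom x = (P.complex.linearYonedaObj R Y).homologyπ i z

variable {X Y : ModuleCat.{u} R} (P : ProjectiveResolution X) (i : ℕ)

lemma exists_represents_class
    (x : ((Ext R (ModuleCat.{u} R) i).obj (Opposite.op X)).obj Y) :
    ∃ φ, Represents P i φ x := by
  obtain ⟨z, hz⟩ := (ModuleCat.epi_iff_surjective
    ((P.complex.linearYonedaObj R Y).homologyπ i)).1 inferInstance ((P.isoExt i Y).hom x)
  exact ⟨_, z, rfl, hz.symm⟩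

lemma exists_represents_cocycle (φ : P.complex.X i ⟶ Y) (hφ : P.complex.d (i + 1) i ≫ φ = 0) :
    ∃ x, Represents P i φ x := by
  let K := P.complex.linearYonedaObj R Y
  obtain ⟨z, hz⟩ : ∃ z : K.cycles i, K.iCycles i z = φ := by
    have hS : (ShortComplex.mk (K.iCycles i) (K.d i (i + 1)) (by simp)).Exact :=
      ShortComplex.exact_of_f_is_kernel _ (K.cyclesIsKernel i (i + 1) (by simp))
    exact (ShortComplex.moduleCat_exact_iff _).1 hS φ hφ
  refine ⟨(P.isoExt i Y).inv (K.homologyπ i z), z, hz, ?_⟩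
  exact (P.isoExt i Y).inv_hom_id_apply _

variable {P i}

lemma Represents.add {φ ψ : P.complex.X i ⟶ Y}
    {x y : ((Ext R (ModuleCat.{u} R) i).obj (Opposite.op X)).obj Y}
    (hx : Represents P i φ x) (hy : Represents P i ψ y) : Represents P i (φ + ψ) (x + y) := by
  obtain ⟨z, rfl, hz⟩ := hx
  obtain ⟨w, rfl, hw⟩ := hy
  exact ⟨z + w, map_add _ _ _, by rw [map_add, hz, hw, map_add]⟩

lemma Represents.smul {φ : P.complex.X i ⟶ Y}
    {x : ((Ext R (ModuleCat.{u} R) i).obj (Opposite.op X)).obj Y}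
    (hx : Represents P i φ x) (a : R) : Represents P i (a • φ) (a • x) := by
  obtain ⟨z, rfl, hz⟩ := hx
  exact ⟨a • z, map_smul _ _ _, by rw [map_smul, hz, map_smul]⟩

lemma represents_zero : Represents P i (0 : P.complex.X i ⟶ Y) 0 :=
  ⟨0, map_zero _, by rw [map_zero, map_zero]⟩

lemma Represents.unique {φ : P.complex.X i ⟶ Y}
    {x y : ((Ext R (ModuleCat.{u} R) i).obj (Opposite.op X)).obj Y}
    (hx : Represents P i φ x) (hy : Represents P i φ y) : x = y := by
  obtain ⟨z, hz, hx⟩ := hx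
  obtain ⟨w, hw, hy⟩ := hy
  have : z = w := (ModuleCat.mono_iff_injective
    ((P.complex.linearYonedaObj R Y).iCycles i)).1 inferInstance (hz.trans hw.symm)
  exact (P.isoExt i Y).toLinearEquiv.injective
    (hx.trans ((congrArg _ this).trans hy.symm))

/-- Writing coboundaries with `prev i` covers all `i` at once: for `i = 0` the predecessor is `0`
itself and the differential `d 0 0` vanishes, so only `φ = 0` qualifies. -/
lemma Represents.eq_zero_iff {φ : P.complex.X i ⟶ Y}
    {x : ((Ext R (ModuleCat.{u} R) i).obj (Opposite.op X)).obj Y} (h : Represents P i φ x) :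
    x = 0 ↔ ∃ ψ : P.complex.X ((ComplexShape.up ℕ).prev i) ⟶ Y,
      φ = P.complex.d i ((ComplexShape.up ℕ).prev i) ≫ ψ := by
  let K := P.complex.linearYonedaObj R Y
  obtain ⟨z, hz, hx⟩ := h
  have hS : (ShortComplex.mk (K.toCycles ((ComplexShape.up ℕ).prev i) i) (K.homologyπ i)
      (by simp)).Exact :=
    ShortComplex.exact_of_g_is_cokernel _ (K.homologyIsCokernel _ i rfl)
  have e : x = 0 ↔ K.homologyπ i z = 0 := by
    rw [← hx]
    refine ⟨fun h => by rw [h, map_zero], fun h => ?_⟩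
    exact (P.isoExt i Y).toLinearEquiv.injective (h.trans (map_zero _).symm)
  have hi := K.toCycles_i ((ComplexShape.up ℕ).prev i) i
  rw [e]
  constructor
  · intro h
    obtain ⟨ψ, hψ⟩ := (ShortComplex.moduleCat_exact_iff _).1 hS z h
    refine ⟨ψ, ?_⟩
    rw [← hz, ← hψ]
    exact congrArg (fun f => f.hom ψ) hi
  · rintro ⟨ψ, hψ⟩
    have : z = K.toCycles ((ComplexShape.up ℕ).prev i) i ψ := by
      refine (ModuleCat.mono_iff_injective (K.iCycles i)).1 inferInstance ?_
      rw [hz, hψ]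
      exact (congrArg (fun f => f.hom ψ) hi).symm
    rw [this]
    exact congrArg (fun f => f.hom ψ) (K.toCycles_comp_homologyπ _ i)

lemma Represents.map {X' : ModuleCat.{u} R} {P' : ProjectiveResolution X'} {f : X' ⟶ X}
    {φ : P.complex.X i ⟶ Y}
    {x : ((Ext R (ModuleCat.{u} R) i).obj (Opposite.op X)).obj Y} (h : Represents P i φ x)
    (κ : P'.complex ⟶ P.complex) (comm : κ.f 0 ≫ P.π.f 0 = P'.π.f 0 ≫ f) :
    Represents P' i (κ.f i ≫ φ) (((Ext R (ModuleCat.{u} R) i).map f.op).app Y x) := by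
  obtain ⟨z, rfl, hz⟩ := h
  refine ⟨cyclesMap (linearYonedaObjMap κ Y) i z, ?_, ?_⟩
  · exact congrArg (fun f => f.hom z) (cyclesMap_i (linearYonedaObjMap κ Y) i)
  · have h1 := congrArg (fun f => f.hom x) (isoExt_hom_naturality f P P' κ comm i Y)
    have h2 := congrArg (fun f => f.hom z) (homologyπ_naturality (linearYonedaObjMap κ Y) i)
    refine h1.trans (Eq.trans ?_ h2)
    exact congrArg (homologyMap (linearYonedaObjMap κ Y) i) hz

end ExtClasses

/-! ### Elements of local cohomology as classes at a finite stage -/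

section LocalCohomologyClasses

open Limits localCohomology Opposite

variable {R : Type u} [CommRing R]

/-- Intersections are lower bounds because the radical commutes with them. The colimit over the
opposite category is thus filtered, so its elements and their vanishing are visible at one ideal. -/
instance isCofiltered_selfLERadical (I : Ideal R) : IsCofiltered (SelfLERadical I) where
  cone_objs J K := ⟨⟨J.obj ⊓ K.obj, by
    rw [Ideal.radical_inf]; exact le_inf J.property K.property⟩,
    ⟨⟨⟨inf_le_left⟩⟩⟩, ⟨⟨⟨inf_le_right⟩⟩⟩, trivial⟩
  cone_maps J K f g := ⟨J, 𝟙 _, rfl⟩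
  nonempty := ⟨default⟩

/-- The projection `R ⧸ J' ⟶ R ⧸ J` for `J' ≤ J`. -/
def quotientMap {J' J : Ideal R} (h : J' ≤ J) :
    ModuleCat.of R (R ⧸ J') ⟶ ModuleCat.of R (R ⧸ J) :=
  ModuleCat.ofHom (Submodule.mapQ J' J LinearMap.id h)

variable (I : Ideal R) (i : ℕ)

/-- Restriction of classes in `Ext^i(R ⧸ J, R)` to a smaller ideal. -/
def extRestrict {J' J : Ideal R} (h : J' ≤ J) :
    ((Ext R (ModuleCat.{u} R) i).obj (op (ModuleCat.of R (R ⧸ J)))).obj (ModuleCat.of R R) ⟶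
      ((Ext R (ModuleCat.{u} R) i).obj (op (ModuleCat.of R (R ⧸ J')))).obj (ModuleCat.of R R) :=
  ((Ext R (ModuleCat.{u} R) i).map (quotientMap h).op).app (ModuleCat.of R R)

variable [IsNoetherianRing R]

/-- The cocone of the modules `Ext^i(R ⧸ J, R)` with vertex local cohomology. -/
def extCocone : Cocone (diagram (selfLERadicalDiagram I) i ⋙
    (evaluation _ _).obj (ModuleCat.of R R)) :=
  have := hasColimitDiagram.{u, u} (selfLERadicalDiagram I) i
  (Cocone.extend ((evaluation _ _).obj (ModuleCat.of R R) |>.mapCocone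
    (colimit.cocone (diagram (selfLERadicalDiagram I) i)))
    ((isoSelfLERadical I i).app (ModuleCat.of R R)).hom)

/-- Local cohomology is a colimit of functors; evaluation at `R` preserves it and gives a colimit of
modules. -/
def extCoconeIsColimit : IsColimit (extCocone I i) :=
  have := hasColimitDiagram.{u, u} (selfLERadicalDiagram I) i
  IsColimit.ofIsoColimit (isColimitOfPreserves ((evaluation _ _).obj (ModuleCat.of R R))
      (colimit.isColimit (diagram (selfLERadicalDiagram I) i)))
    (Cocone.ext ((isoSelfLERadical I i).app (ModuleCat.of R R)) fun _ => rfl)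

variable {I i}

lemma extToLocalCohomology_restrict {J' J : SelfLERadical I} (h : J'.obj ≤ J.obj)
    (x : ((Ext R (ModuleCat.{u} R) i).obj (op (ModuleCat.of R (R ⧸ J.obj)))).obj
      (ModuleCat.of R R)) :
    extToLocalCohomology I i J' (extRestrict i h x) = extToLocalCohomology I i J x :=
  congrArg (fun f => f.hom x)
    ((extCocone I i).w (Quiver.Hom.op (⟨⟨⟨h⟩⟩⟩ : J' ⟶ J)))

lemma exists_extToLocalCohomology_eq
    (y : (localCohomology I i).obj (ModuleCat.of R R)) :
    ∃ (J : SelfLERadical I) (x : _), extToLocalCohomology I i J x = y := by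
  obtain ⟨J, x, hx⟩ := Concrete.isColimit_exists_rep _ (extCoconeIsColimit I i) y
  exact ⟨J.unop, x, hx⟩

lemma extToLocalCohomology_eq_zero {J : SelfLERadical I}
    {x : ((Ext R (ModuleCat.{u} R) i).obj (op (ModuleCat.of R (R ⧸ J.obj)))).obj
      (ModuleCat.of R R)} (hx : extToLocalCohomology I i J x = 0) :
    ∃ (J' : SelfLERadical I) (h : J'.obj ≤ J.obj), extRestrict i h x = 0 := by
  obtain ⟨J', f, g, h⟩ := Concrete.isColimit_exists_of_rep_eq _ (extCoconeIsColimit I i) x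
    (0 : ((Ext R (ModuleCat.{u} R) i).obj (op (ModuleCat.of R (R ⧸ J.obj)))).obj
      (ModuleCat.of R R)) (i := op J) (j := op J) (hx.trans (map_zero _).symm)
  exact ⟨J'.unop, f.unop.hom.down.down, h.trans (map_zero _)⟩

end LocalCohomologyClasses

/-! ### Internal `ℤ`-gradings of abelian groups -/

section GradedGroups

variable {M N : Type*} [AddCommGroup M] [AddCommGroup N] {ℳ : ℤ → AddSubgroup M}
  {𝒩 : ℤ → AddSubgroup N}

lemma isInternal_iSup_eq_top (h : DirectSum.IsInternal ℳ) : iSup ℳ = ⊤ := by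
  rw [eq_top_iff]
  intro m _
  obtain ⟨x, rfl⟩ := h.2 m
  induction x using DirectSum.induction_on with
  | zero => simp
  | of i x => simpa using AddSubgroup.mem_iSup_of_mem i x.2
  | add x y hx hy =>
    rw [map_add]
    exact add_mem (hx trivial) (hy trivial)

lemma isInternal_induction (h : DirectSum.IsInternal ℳ) {p : M → Prop} (zero : p 0)
    (add : ∀ x y, p x → p y → p (x + y)) (mem : ∀ e, ∀ m ∈ ℳ e, p m) (m : M) : p m :=
  AddSubgroup.iSup_induction ℳ (C := p) (isInternal_iSup_eq_top h ▸ AddSubgroup.mem_top m)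
    mem zero add

lemma coeAddMonoidHom_surjective (span : iSup ℳ = ⊤) :
    Function.Surjective (DirectSum.coeAddMonoidHom ℳ) := by
  intro m
  refine AddSubgroup.iSup_induction ℳ (C := fun m => ∃ x, DirectSum.coeAddMonoidHom ℳ x = m)
    (span ▸ AddSubgroup.mem_top m)
    (fun e m hm => ⟨DirectSum.of (fun e => ℳ e) e ⟨m, hm⟩, DirectSum.coeAddMonoidHom_of _ _ _⟩)
    ⟨0, map_zero _⟩ ?_
  rintro _ _ ⟨x, rfl⟩ ⟨y, rfl⟩
  exact ⟨x + y, map_add _ _ _⟩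

/-- Homogeneous elements that sum to zero are zero if this can be detected by degree preserving
maps to internally graded groups. -/
lemma isInternal_of_jointly_injective {ι : Type*} {N : ι → Type*} [∀ i, AddCommGroup (N i)]
    {𝒩 : ∀ i, ℤ → AddSubgroup (N i)} (h : ∀ i, DirectSum.IsInternal (𝒩 i))
    (g : ∀ i, M →+ N i) (hg : ∀ i e, ∀ m ∈ ℳ e, g i m ∈ 𝒩 i e)
    (inj : ∀ m, (∀ i, g i m = 0) → m = 0) (span : iSup ℳ = ⊤) : DirectSum.IsInternal ℳ := by
  refine ⟨(injective_iff_map_eq_zero _).2 fun x hx => ?_, coeAddMonoidHom_surjective span⟩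
  have key : ∀ (i : ι) (e : ℤ), g i (x e) = 0 := by
    intro i e
    let G : (DirectSum ℤ fun e => ℳ e) →+ DirectSum ℤ fun e => 𝒩 i e :=
      DirectSum.map fun e => ((g i).comp (ℳ e).subtype).codRestrict (𝒩 i e)
        fun m => hg i e m m.2
    have hc : (DirectSum.coeAddMonoidHom (𝒩 i)).comp G =
        (g i).comp (DirectSum.coeAddMonoidHom ℳ) := by
      refine DirectSum.addHom_ext fun e m => ?_
      simp only [AddMonoidHom.comp_apply, G, DirectSum.map_of,
        DirectSum.coeAddMonoidHom_of]
      rfl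
    have h0 : G x = 0 := (h i).1 (by
      rw [map_zero]
      exact (DFunLike.congr_fun hc x).trans ((congrArg (g i) hx).trans (map_zero _)))
    have := DFunLike.congr_fun h0 e
    exact (congrArg Subtype.val (DirectSum.map_apply _ e x)).symm.trans (congrArg Subtype.val this)
  refine DFinsupp.ext fun e => Subtype.ext (inj _ fun i => key i e)

lemma isInternal_shift (h : DirectSum.IsInternal ℳ) (d : ℤ) :
    DirectSum.IsInternal fun e => ℳ (e - d) := by
  have hi : (fun e => (ℳ (e - d))) = ℳ ∘ (Equiv.subRight d) := rfl
  have hs : iSup (fun e => ℳ (e - d)) = ⊤ := by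
    exact (Equiv.iSup_comp (Equiv.subRight d)).trans (isInternal_iSup_eq_top h)
  have hind : iSupIndep (fun e => ℳ (e - d)) := by
    rw [hi]
    exact h.addSubgroup_iSupIndep.comp (Equiv.injective _)
  exact ⟨hind.dfinsuppSumAddHom_injective, coeAddMonoidHom_surjective hs⟩

/-- The projection onto the degree `e` part of an internally graded group. -/
def component (h : DirectSum.IsInternal ℳ) (e : ℤ) : M →+ M :=
  ((ℳ e).subtype.comp (DFinsupp.evalAddMonoidHom e)).comp
    (AddEquiv.ofBijective (DirectSum.coeAddMonoidHom ℳ) h).symm.toAddMonoidHom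

lemma component_mem (h : DirectSum.IsInternal ℳ) (e : ℤ) (m : M) : component h e m ∈ ℳ e :=
  Subtype.property _

lemma component_of_mem (h : DirectSum.IsInternal ℳ) (e e' : ℤ) {m : M} (hm : m ∈ ℳ e') :
    component h e m = if e' = e then m else 0 := by
  have hs : (AddEquiv.ofBijective (DirectSum.coeAddMonoidHom ℳ) h).symm m =
      DirectSum.of (fun e => ℳ e) e' ⟨m, hm⟩ := by
    rw [AddEquiv.symm_apply_eq]
    exact (DirectSum.coeAddMonoidHom_of ℳ e' ⟨m, hm⟩).symm
  have : component h e m = ((DirectSum.of (fun e => ℳ e) e' ⟨m, hm⟩ : DirectSum ℤ _) e : M) :=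
    congrArg (fun x : DirectSum ℤ fun e => ℳ e => (x e : M)) hs
  rw [this, DirectSum.of_apply]
  split_ifs with h'
  · subst h'; rfl
  · rfl

lemma component_of_mem_same (h : DirectSum.IsInternal ℳ) {e : ℤ} {m : M} (hm : m ∈ ℳ e) :
    component h e m = m := by
  rw [component_of_mem h e e hm, if_pos rfl]

lemma isInternal_of_proj (π : ℤ → M →+ M) (same : ∀ e, ∀ m ∈ ℳ e, π e m = m)
    (ne : ∀ e e', e' ≠ e → ∀ m ∈ ℳ e', π e m = 0) (span : iSup ℳ = ⊤) :
    DirectSum.IsInternal ℳ := by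
  refine ⟨(injective_iff_map_eq_zero _).2 fun x hx => ?_, coeAddMonoidHom_surjective span⟩
  refine DFinsupp.ext fun e => Subtype.ext ?_
  have hc : (π e).comp (DirectSum.coeAddMonoidHom ℳ) =
      (ℳ e).subtype.comp (DFinsupp.evalAddMonoidHom e) := by
    refine DirectSum.addHom_ext fun e' m => ?_
    simp only [AddMonoidHom.comp_apply, DirectSum.coeAddMonoidHom_of]
    change _ = ((DirectSum.of (fun e => ℳ e) e' m : DirectSum ℤ _) e : M)
    rw [DirectSum.of_apply]
    split_ifs with h
    · subst h; exact same _ _ m.2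
    · exact ne _ _ h _ m.2
  exact (DFunLike.congr_fun hc x).symm.trans ((congrArg (π e) hx).trans (map_zero _))

lemma addHom_ext_of_isInternal (h : DirectSum.IsInternal ℳ) {f g : M →+ N}
    (hfg : ∀ e, ∀ m ∈ ℳ e, f m = g m) : f = g := by
  ext m
  refine isInternal_induction h (by simp) (fun x y hx hy => ?_) hfg m
  rw [map_add, map_add, hx, hy]

end GradedGroups

/-! ### Graded modules and degree parts of linear maps -/

section GradedModules

variable {K : Type*} {R : Type u} [CommRing K] [CommRing R] [Algebra K R]
  {𝒜 : ℕ → Submodule K R}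
variable {M N L : Type*} [AddCommGroup M] [Module R M] [AddCommGroup N] [Module R N]
  [AddCommGroup L] [Module R L]
  {ℳ : ℤ → AddSubgroup M} {𝒩 : ℤ → AddSubgroup N} {ℒ : ℤ → AddSubgroup L}

/-- The linear map `φ` raises degrees by `e`. -/
def HasDegree (ℳ : ℤ → AddSubgroup M) (𝒩 : ℤ → AddSubgroup N) (φ : M →ₗ[R] N) (e : ℤ) : Prop :=
  ∀ j, ∀ m ∈ ℳ j, φ m ∈ 𝒩 (j + e)

lemma mem_intDegree_natCast {a : R} {i : ℕ} : a ∈ intDegree 𝒜 i ↔ a ∈ 𝒜 i := by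
  simp [intDegree]

lemma intDegree_of_neg {e : ℤ} (he : e < 0) : intDegree 𝒜 e = ⊥ := by
  simp [intDegree, he]

lemma isGradedModule_intDegree (𝒜 : ℕ → Submodule K R) [GradedRing 𝒜] :
    IsGradedModule 𝒜 (intDegree 𝒜) where
  isInternal := by
    refine isInternal_of_proj (fun e => if 0 ≤ e then GradedRing.proj 𝒜 e.toNat else 0)
      (fun e m hm => ?_) (fun e e' h m hm => ?_) ?_
    · unfold intDegree at hm
      split_ifs at hm with he
      · simpa [he] using DirectSum.decompose_of_mem_same 𝒜 hm
      · simp [AddSubgroup.mem_bot.1 hm]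
    · unfold intDegree at hm
      split_ifs at hm with he
      · split_ifs with he'
        · exact DirectSum.decompose_of_mem_ne 𝒜 hm (by omega)
        · rfl
      · simp [AddSubgroup.mem_bot.1 hm]
    · rw [eq_top_iff]
      intro a _
      induction a using DirectSum.Decomposition.inductionOn 𝒜 with
      | zero => exact zero_mem _
      | @homogeneous i a => exact AddSubgroup.mem_iSup_of_mem (i : ℤ) (mem_intDegree_natCast.2 a.2)
      | add a b ha hb => exact add_mem (ha trivial) (hb trivial)
  smul_mem i d a m ha hm := by
    unfold intDegree at hm
    split_ifs at hm with hd
    · lift d to ℕ using hd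
      rw [← Nat.cast_add, mem_intDegree_natCast]
      exact SetLike.mul_mem_graded ha hm
    · rw [AddSubgroup.mem_bot.1 hm, smul_zero]
      exact zero_mem _

lemma IsGradedModule.shift (h : IsGradedModule 𝒜 ℳ) (d : ℤ) :
    IsGradedModule 𝒜 fun e => ℳ (e - d) where
  isInternal := isInternal_shift h.isInternal d
  smul_mem i e a m ha hm := by
    rw [add_sub_assoc]
    exact h.smul_mem i _ a m ha hm

lemma IsGradedModule.prod (hM : IsGradedModule 𝒜 ℳ) (hN : IsGradedModule 𝒜 𝒩) :
    IsGradedModule 𝒜 fun e => (ℳ e).prod (𝒩 e) where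
  isInternal := by
    refine isInternal_of_proj
      (fun e => (component hM.isInternal e).prodMap (component hN.isInternal e)) ?_ ?_ ?_
    · rintro e ⟨m, n⟩ ⟨hm, hn⟩
      exact Prod.ext (component_of_mem_same _ hm) (component_of_mem_same _ hn)
    · rintro e e' h ⟨m, n⟩ ⟨hm, hn⟩
      exact Prod.ext ((component_of_mem _ _ _ hm).trans (if_neg h))
        ((component_of_mem _ _ _ hn).trans (if_neg h))
    · rw [eq_top_iff]
      rintro ⟨m, n⟩ _
      have h1 : (m, (0 : N)) ∈ ⨆ e, (ℳ e).prod (𝒩 e) := by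
        refine isInternal_induction hM.isInternal
          (p := fun m => (m, (0 : N)) ∈ ⨆ e, (ℳ e).prod (𝒩 e)) (zero_mem _)
          (fun x y hx hy => by simpa using add_mem hx hy)
          (fun e m hm => AddSubgroup.mem_iSup_of_mem e ⟨hm, zero_mem _⟩) m
      have h2 : ((0 : M), n) ∈ ⨆ e, (ℳ e).prod (𝒩 e) := by
        refine isInternal_induction hN.isInternal
          (p := fun n => ((0 : M), n) ∈ ⨆ e, (ℳ e).prod (𝒩 e)) (zero_mem _)
          (fun x y hx hy => by simpa using add_mem hx hy)
          (fun e m hm => AddSubgroup.mem_iSup_of_mem e ⟨zero_mem _, hm⟩) n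
      simpa using add_mem h1 h2
  smul_mem i d a m ha hm := ⟨hM.smul_mem i d a _ ha hm.1, hN.smul_mem i d a _ ha hm.2⟩

lemma IsGradedModule.component_smul (h : IsGradedModule 𝒜 ℳ) {i : ℕ} {a : R} (ha : a ∈ 𝒜 i)
    (e : ℤ) (m : M) :
    component h.isInternal (i + e) (a • m) = a • component h.isInternal e m := by
  refine isInternal_induction h.isInternal
    (p := fun m => component h.isInternal (i + e) (a • m) = a • component h.isInternal e m)
    (by simp) (fun x y hx hy => by simp only [smul_add, map_add, hx, hy]) (fun d m hm => ?_) m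
  rw [component_of_mem _ _ _ hm, component_of_mem _ _ _ (h.smul_mem i d a m ha hm)]
  simp

lemma HasDegree.map_component {φ : M →ₗ[R] N} {e : ℤ} (hφ : HasDegree ℳ 𝒩 φ e)
    (hM : DirectSum.IsInternal ℳ) (hN : DirectSum.IsInternal 𝒩) (j : ℤ) (m : M) :
    φ (component hM j m) = component hN (j + e) (φ m) := by
  refine isInternal_induction hM
    (p := fun m => φ (component hM j m) = component hN (j + e) (φ m)) (by simp)
    (fun x y hx hy => by simp only [map_add, hx, hy]) (fun d m hm => ?_) m
  rw [component_of_mem _ _ _ hm, component_of_mem _ _ _ (hφ d m hm)]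
  simp only [add_left_inj]
  split_ifs <;> simp

/-- A map of degree zero commutes with taking components, so the components of an element of the
kernel stay in the kernel. -/
lemma IsGradedModule.ker (hM : IsGradedModule 𝒜 ℳ) (hN : IsGradedModule 𝒜 𝒩) {φ : M →ₗ[R] N}
    (hφ : HasDegree ℳ 𝒩 φ 0) :
    IsGradedModule 𝒜 fun e => (ℳ e).comap (LinearMap.ker φ).subtype.toAddMonoidHom where
  isInternal := by
    have hk : ∀ e, ∀ m ∈ LinearMap.ker φ, component hM.isInternal e m ∈ LinearMap.ker φ := by
      intro e m hm
      rw [LinearMap.mem_ker, hφ.map_component hM.isInternal hN.isInternal, LinearMap.mem_ker.1 hm,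
        map_zero]
    refine isInternal_of_jointly_injective (ι := Unit) (fun _ => hM.isInternal)
      (fun _ => (LinearMap.ker φ).subtype.toAddMonoidHom) (fun _ e m hm => hm)
      (fun m hm => Subtype.ext (hm ())) ?_
    rw [eq_top_iff]
    rintro ⟨m, hm⟩ _
    let s := (AddEquiv.ofBijective (DirectSum.coeAddMonoidHom ℳ) hM.isInternal).symm m
    classical
    have hs : (⟨m, hm⟩ : LinearMap.ker φ) =
        ∑ e ∈ DFinsupp.support s, ⟨component hM.isInternal e m, hk e m hm⟩ := by
      refine Subtype.ext ?_
      rw [AddSubmonoidClass.coe_finsetSum]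
      have h1 : DirectSum.coeAddMonoidHom ℳ s = m :=
        (AddEquiv.ofBijective (DirectSum.coeAddMonoidHom ℳ) hM.isInternal).apply_symm_apply m
      rw [DirectSum.coeAddMonoidHom_eq_dfinsuppSum] at h1
      exact h1.symm
    rw [hs]
    exact sum_mem fun e _ => AddSubgroup.mem_iSup_of_mem e (component_mem hM.isInternal e m)
  smul_mem i d a m ha hm := hM.smul_mem i d a m ha hm

/-- A homogeneous ideal is stable under the component projections of `R`, which therefore descend to
`R ⧸ J`. -/
lemma isGradedModule_quotient [GradedRing 𝒜] {J : Ideal R} (hJ : J.IsHomogeneous 𝒜) :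
    IsGradedModule 𝒜 fun e => (intDegree 𝒜 e).map (Ideal.Quotient.mk J).toAddMonoidHom where
  isInternal := by
    have hR := isGradedModule_intDegree 𝒜
    have hk : ∀ e, ∀ a ∈ J, component hR.isInternal e a ∈ J := by
      intro e a ha
      rcases lt_or_ge e 0 with he | he
      · have := component_mem hR.isInternal e a
        rw [intDegree_of_neg he] at this
        rw [AddSubgroup.mem_bot.1 this]
        exact zero_mem _
      · lift e to ℕ using he
        have : component hR.isInternal (e : ℤ) = GradedRing.proj 𝒜 e := by
          refine addHom_ext_of_isInternal hR.isInternal fun d a ha => ?_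
          rw [component_of_mem _ _ _ ha]
          rcases lt_or_ge d 0 with hd | hd
          · rw [intDegree_of_neg hd] at ha
            simp [AddSubgroup.mem_bot.1 ha]
          · lift d to ℕ using hd
            rw [mem_intDegree_natCast] at ha
            split_ifs with h
            · obtain rfl : d = e := by exact_mod_cast h
              exact (DirectSum.decompose_of_mem_same 𝒜 ha).symm
            · exact (DirectSum.decompose_of_mem_ne 𝒜 ha (by exact_mod_cast h)).symm
        rw [this]
        exact hJ e ha
    let q : R →+ R ⧸ J := (Ideal.Quotient.mk J).toAddMonoidHom
    have hq : Function.Surjective q := Ideal.Quotient.mk_surjective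
    let π : ℤ → R ⧸ J →+ R ⧸ J := fun e => q.liftOfSurjective hq
      ⟨q.comp (component hR.isInternal e), fun a ha =>
        Ideal.Quotient.eq_zero_iff_mem.2 (hk e a (Ideal.Quotient.eq_zero_iff_mem.1 ha))⟩
    have hπ : ∀ e a, π e (q a) = q (component hR.isInternal e a) := fun e a =>
      q.liftOfRightInverse_comp_apply _ (Function.rightInverse_surjInv hq) _ a
    refine isInternal_of_proj π ?_ ?_ ?_
    · rintro e _ ⟨a, ha, rfl⟩
      exact (hπ e a).trans (congrArg q (component_of_mem_same _ ha))
    · rintro e e' h _ ⟨a, ha, rfl⟩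
      exact (hπ e a).trans ((congrArg q ((component_of_mem _ _ _ ha).trans (if_neg h))).trans
        (map_zero q))
    · rw [← AddSubgroup.map_iSup, isInternal_iSup_eq_top hR.isInternal,
        ← AddMonoidHom.range_eq_map, AddMonoidHom.range_eq_top]
      exact hq
  smul_mem := by
    rintro i d a _ ha ⟨b, hb, rfl⟩
    exact ⟨a • b, (isGradedModule_intDegree 𝒜).smul_mem i d a b ha hb, rfl⟩

/-- The grading of the free module `ι →₀ R` with the basis vector `i` in degree `δ i`. -/
def finsuppDegree (𝒜 : ℕ → Submodule K R) {ι : Type*} (δ : ι → ℤ) (e : ℤ) :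
    AddSubgroup (ι →₀ R) where
  carrier := {x | ∀ i, x i ∈ intDegree 𝒜 (e - δ i)}
  add_mem' hx hy i := add_mem (hx i) (hy i)
  zero_mem' _ := zero_mem _
  neg_mem' hx i := neg_mem (hx i)

lemma single_mem_finsuppDegree {ι : Type*} {δ : ι → ℤ} {e : ℤ} {i : ι} {a : R}
    (ha : a ∈ intDegree 𝒜 (e - δ i)) : Finsupp.single i a ∈ finsuppDegree 𝒜 δ e := by
  classical
  intro j
  rw [Finsupp.single_apply]
  split_ifs with h
  · subst h; exact ha
  · exact zero_mem _

lemma isGradedModule_finsupp [GradedRing 𝒜] {ι : Type*} (δ : ι → ℤ) :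
    IsGradedModule 𝒜 (finsuppDegree 𝒜 δ) where
  isInternal := by
    have h := fun i => ((isGradedModule_intDegree 𝒜).shift (δ i)).isInternal
    refine isInternal_of_jointly_injective h
      (fun i => Finsupp.applyAddHom i) (fun i e m hm => hm i)
      (fun m hm => Finsupp.ext hm) ?_
    rw [eq_top_iff]
    intro x _
    induction x using Finsupp.induction_linear with
    | zero => exact zero_mem _
    | add x y hx hy => exact add_mem (hx trivial) (hy trivial)
    | single i a =>
      refine isInternal_induction (h i)
        (p := fun a => Finsupp.single i a ∈ ⨆ e : ℤ, finsuppDegree 𝒜 δ e)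
        ?_ (fun x y hx hy => ?_) (fun e a ha => ?_) a
      · rw [Finsupp.single_zero]; exact zero_mem _
      · rw [Finsupp.single_add]; exact add_mem hx hy
      · exact AddSubgroup.mem_iSup_of_mem e (single_mem_finsuppDegree ha)
  smul_mem k d a m ha hm i :=
    ((isGradedModule_intDegree 𝒜).shift (δ i)).smul_mem k d a (m i) ha (hm i)

/-- The map is prescribed on each homogeneous part and extended additively; linearity is checked on
homogeneous scalars. No finite generation is needed, although `φ` need not be a finite sum of its
degree parts. -/
lemma exists_degreePart [GradedRing 𝒜] (hM : IsGradedModule 𝒜 ℳ) (hN : IsGradedModule 𝒜 𝒩)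
    (φ : M →ₗ[R] N) (e : ℤ) :
    ∃ ψ : M →ₗ[R] N, ∀ j, ∀ m ∈ ℳ j, ψ m = component hN.isInternal (j + e) (φ m) := by
  let ψ : M →+ N := (DirectSum.toAddMonoid fun j =>
    ((component hN.isInternal (j + e)).comp φ.toAddMonoidHom).comp (ℳ j).subtype).comp
      (AddEquiv.ofBijective (DirectSum.coeAddMonoidHom ℳ) hM.isInternal).symm.toAddMonoidHom
  have hψ : ∀ j, ∀ m ∈ ℳ j, ψ m = component hN.isInternal (j + e) (φ m) := by
    intro j m hm
    have hs : (AddEquiv.ofBijective (DirectSum.coeAddMonoidHom ℳ) hM.isInternal).symm m =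
        DirectSum.of (fun e => ℳ e) j ⟨m, hm⟩ := by
      rw [AddEquiv.symm_apply_eq]
      exact (DirectSum.coeAddMonoidHom_of ℳ j ⟨m, hm⟩).symm
    refine (congrArg (DirectSum.toAddMonoid fun j =>
      ((component hN.isInternal (j + e)).comp φ.toAddMonoidHom).comp (ℳ j).subtype) hs).trans ?_
    rw [DirectSum.toAddMonoid_of]
    rfl
  refine ⟨{ ψ with map_smul' := fun a m => ?_ }, hψ⟩
  change ψ (a • m) = a • ψ m
  induction a using DirectSum.Decomposition.inductionOn 𝒜 with
  | zero => simp
  | add a b ha hb => rw [add_smul, map_add, ha, hb, add_smul]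
  | @homogeneous i a =>
    refine isInternal_induction hM.isInternal
      (p := fun m => ψ ((a : R) • m) = (a : R) • ψ m) (by simp)
      (fun x y hx hy => by simp only [smul_add, map_add, hx, hy]) (fun j m hm => ?_) m
    rw [hψ j m hm, hψ _ _ (hM.smul_mem i j a m a.2 hm), map_smul, add_assoc,
      hN.component_smul a.2]

/-- The degree `e` part of a linear map between graded modules. -/
def degreePart [GradedRing 𝒜] (hM : IsGradedModule 𝒜 ℳ) (hN : IsGradedModule 𝒜 𝒩)
    (φ : M →ₗ[R] N) (e : ℤ) : M →ₗ[R] N :=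
  (exists_degreePart hM hN φ e).choose

section DegreePart

variable [GradedRing 𝒜] (hM : IsGradedModule 𝒜 ℳ) (hN : IsGradedModule 𝒜 𝒩)
  (hL : IsGradedModule 𝒜 ℒ)

lemma degreePart_apply (φ : M →ₗ[R] N) (e : ℤ) {j : ℤ} {m : M} (hm : m ∈ ℳ j) :
    degreePart hM hN φ e m = component hN.isInternal (j + e) (φ m) :=
  (exists_degreePart hM hN φ e).choose_spec j m hm

omit [GradedRing 𝒜] in
include hM in
lemma linearMap_ext_of_isGradedModule {φ ψ : M →ₗ[R] N} (h : ∀ j, ∀ m ∈ ℳ j, φ m = ψ m) :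
    φ = ψ :=
  LinearMap.toAddMonoidHom_injective (addHom_ext_of_isInternal hM.isInternal h)

lemma hasDegree_degreePart (φ : M →ₗ[R] N) (e : ℤ) : HasDegree ℳ 𝒩 (degreePart hM hN φ e) e := by
  intro j m hm
  rw [degreePart_apply hM hN φ e hm]
  exact component_mem _ _ _

lemma HasDegree.degreePart_eq {φ : M →ₗ[R] N} {d : ℤ} (hφ : HasDegree ℳ 𝒩 φ d) (e : ℤ) :
    degreePart hM hN φ e = if d = e then φ else 0 := by
  refine linearMap_ext_of_isGradedModule hM fun j m hm => ?_
  rw [degreePart_apply hM hN φ e hm, component_of_mem _ _ _ (hφ j m hm)]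
  simp only [add_right_inj]
  split_ifs <;> rfl

lemma degreePart_sum {ι : Type*} (s : Finset ι) (φ : ι → M →ₗ[R] N) (e : ℤ) :
    degreePart hM hN (∑ i ∈ s, φ i) e = ∑ i ∈ s, degreePart hM hN (φ i) e := by
  refine linearMap_ext_of_isGradedModule hM fun j m hm => ?_
  rw [degreePart_apply hM hN _ e hm]
  simp [LinearMap.sum_apply, degreePart_apply hM hN _ e hm]

lemma degreePart_comp_right {δ : L →ₗ[R] M} (hδ : HasDegree ℒ ℳ δ 0) (φ : M →ₗ[R] N) (e : ℤ) :
    degreePart hL hN (φ ∘ₗ δ) e = degreePart hM hN φ e ∘ₗ δ := by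
  refine linearMap_ext_of_isGradedModule hL fun j m hm => ?_
  have := hδ j m hm
  rw [add_zero] at this
  rw [LinearMap.comp_apply, degreePart_apply hL hN _ e hm, degreePart_apply hM hN _ e this,
    LinearMap.comp_apply]

lemma degreePart_comp_left {δ : N →ₗ[R] L} (hδ : HasDegree 𝒩 ℒ δ 0) (φ : M →ₗ[R] N) (e : ℤ) :
    degreePart hM hL (δ ∘ₗ φ) e = δ ∘ₗ degreePart hM hN φ e := by
  refine linearMap_ext_of_isGradedModule hM fun j m hm => ?_
  rw [LinearMap.comp_apply, degreePart_apply hM hL _ e hm, degreePart_apply hM hN _ e hm,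
    hδ.map_component hN.isInternal hL.isInternal, add_zero, LinearMap.comp_apply]

end DegreePart

end GradedModules

/-! ### Graded free resolutions by iterated syzygies -/

section FreeResolution

variable {K : Type*} {R : Type u} [CommRing K] [CommRing R] [Algebra K R]

/-- A graded module, as a bundled object. -/
structure GradedMod (𝒜 : ℕ → Submodule K R) where
  /-- The underlying module. -/
  carrier : ModuleCat.{u} R
  /-- The homogeneous parts. -/
  deg : ℤ → AddSubgroup carrier
  isGradedModule : IsGradedModule 𝒜 deg

variable {𝒜 : ℕ → Submodule K R}

namespace GradedMod

/-- The homogeneous elements of a graded module, with their degrees. -/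
abbrev Index (M : GradedMod 𝒜) : Type u := Σ e : ℤ, M.deg e

/-- The map to `M` from the free module on the homogeneous elements of `M`. -/
def cover (M : GradedMod 𝒜) : (M.Index →₀ R) →ₗ[R] M.carrier :=
  Finsupp.linearCombination R fun i => (i.2 : M.carrier)

/-- The grading on the free module on the homogeneous elements of `M`. -/
def coverDegree (M : GradedMod 𝒜) : ℤ → AddSubgroup (M.Index →₀ R) :=
  finsuppDegree 𝒜 fun i => i.1

lemma smul_mem_of_mem_intDegree (M : GradedMod 𝒜) {a : R} {e d : ℤ} {m : M.carrier}
    (ha : a ∈ intDegree 𝒜 e) (hm : m ∈ M.deg d) : a • m ∈ M.deg (e + d) := by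
  rcases lt_or_ge e 0 with he | he
  · rw [intDegree_of_neg he] at ha
    rw [AddSubgroup.mem_bot.1 ha, zero_smul]
    exact zero_mem _
  · lift e to ℕ using he
    exact M.isGradedModule.smul_mem _ _ _ _ (mem_intDegree_natCast.1 ha) hm

lemma hasDegree_cover (M : GradedMod 𝒜) : HasDegree M.coverDegree M.deg M.cover 0 := by
  intro j x hx
  rw [add_zero, cover, Finsupp.linearCombination_apply]
  refine sum_mem fun i _ => ?_
  simpa using M.smul_mem_of_mem_intDegree (hx i) i.2.2

variable [GradedRing 𝒜]

lemma isGradedModule_coverDegree (M : GradedMod 𝒜) : IsGradedModule 𝒜 M.coverDegree :=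
  isGradedModule_finsupp _

omit [GradedRing 𝒜] in
lemma cover_surjective (M : GradedMod 𝒜) : Function.Surjective M.cover := by
  intro m
  refine isInternal_induction M.isGradedModule.isInternal (p := fun m => ∃ x, M.cover x = m)
    ⟨0, map_zero _⟩ ?_ (fun e m hm => ⟨Finsupp.single ⟨e, m, hm⟩ 1, ?_⟩) m
  · rintro _ _ ⟨x, rfl⟩ ⟨y, rfl⟩
    exact ⟨x + y, map_add _ _ _⟩
  · rw [cover, Finsupp.linearCombination_single, one_smul]

/-- The kernel of the free cover of `M`. -/
def syzygy (M : GradedMod 𝒜) : GradedMod 𝒜 where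
  carrier := ModuleCat.of R (LinearMap.ker M.cover)
  deg e := (M.coverDegree e).comap (LinearMap.ker M.cover).subtype.toAddMonoidHom
  isGradedModule := M.isGradedModule_coverDegree.ker M.isGradedModule M.hasDegree_cover

/-- The inclusion of the syzygy module in the free cover. -/
def syzygyι (M : GradedMod 𝒜) : M.syzygy.carrier →ₗ[R] (M.Index →₀ R) :=
  (LinearMap.ker M.cover).subtype

lemma syzygyι_injective (M : GradedMod 𝒜) : Function.Injective M.syzygyι :=
  (LinearMap.ker M.cover).injective_subtype

lemma range_syzygyι (M : GradedMod 𝒜) : LinearMap.range M.syzygyι = LinearMap.ker M.cover :=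
  Submodule.range_subtype _

/-- The iterated syzygies of `M`. -/
def iterSyzygy (M : GradedMod 𝒜) : ℕ → GradedMod 𝒜
  | 0 => M
  | n + 1 => (M.iterSyzygy n).syzygy

/-- The differential of the free resolution of `M`. -/
def resolutionD (M : GradedMod 𝒜) (n : ℕ) :
    ((M.iterSyzygy (n + 1)).Index →₀ R) →ₗ[R] ((M.iterSyzygy n).Index →₀ R) :=
  (M.iterSyzygy n).syzygyι ∘ₗ (M.iterSyzygy (n + 1)).cover

lemma range_resolutionD (M : GradedMod 𝒜) (n : ℕ) :
    LinearMap.range (M.resolutionD n) = LinearMap.ker (M.iterSyzygy n).cover := by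
  rw [← range_syzygyι, resolutionD]
  exact LinearMap.range_comp_of_range_eq_top _
    (LinearMap.range_eq_top.2 (M.iterSyzygy (n + 1)).cover_surjective)

lemma ker_resolutionD (M : GradedMod 𝒜) (n : ℕ) :
    LinearMap.ker (M.resolutionD n) = LinearMap.ker (M.iterSyzygy (n + 1)).cover :=
  LinearMap.ker_comp_of_ker_eq_bot _ (LinearMap.ker_eq_bot.2 (M.iterSyzygy n).syzygyι_injective)

lemma hasDegree_resolutionD (M : GradedMod 𝒜) (n : ℕ) :
    HasDegree (M.iterSyzygy (n + 1)).coverDegree (M.iterSyzygy n).coverDegree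
      (M.resolutionD n) 0 :=
  (M.iterSyzygy (n + 1)).hasDegree_cover

/-- The free resolution of `M`, as a complex. -/
def resolutionComplex (M : GradedMod 𝒜) : ChainComplex (ModuleCat.{u} R) ℕ :=
  ChainComplex.of (fun n => ModuleCat.of R ((M.iterSyzygy n).Index →₀ R))
    (fun n => ModuleCat.ofHom (M.resolutionD n)) fun n => by
      rw [← ModuleCat.ofHom_comp]
      refine congrArg ModuleCat.ofHom (LinearMap.ext fun x => ?_)
      have : M.resolutionD (n + 1) x ∈ LinearMap.range (M.resolutionD (n + 1)) := ⟨x, rfl⟩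
      rw [range_resolutionD, ← ker_resolutionD] at this
      exact this

lemma resolutionComplex_d (M : GradedMod 𝒜) (n : ℕ) :
    M.resolutionComplex.d (n + 1) n = ModuleCat.ofHom (M.resolutionD n) :=
  ChainComplex.of_d (fun n => ModuleCat.of R ((M.iterSyzygy n).Index →₀ R))
    (fun n => ModuleCat.ofHom (M.resolutionD n)) n

lemma resolutionComplex_exactAt_succ (M : GradedMod 𝒜) (n : ℕ) :
    M.resolutionComplex.ExactAt (n + 1) := by
  rw [HomologicalComplex.exactAt_iff' _ (n + 1 + 1) (n + 1) n (by simp) (by simp),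
    ShortComplex.moduleCat_exact_iff_range_eq_ker]
  have h1 := M.resolutionComplex_d (n + 1)
  have h2 := M.resolutionComplex_d n
  change LinearMap.range (M.resolutionComplex.d (n + 1 + 1) (n + 1)).hom =
    LinearMap.ker (M.resolutionComplex.d (n + 1) n).hom
  rw [h1, h2]
  exact (M.range_resolutionD (n + 1)).trans (M.ker_resolutionD n).symm

/-- The augmentation of the free resolution of `M`. -/
def augmentation (M : GradedMod 𝒜) : M.resolutionComplex.X 0 ⟶ M.carrier :=
  ModuleCat.ofHom M.cover

lemma resolutionComplex_d_augmentation (M : GradedMod 𝒜) :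
    M.resolutionComplex.d 1 0 ≫ M.augmentation = 0 := by
  rw [resolutionComplex_d]
  refine ModuleCat.hom_ext (LinearMap.ext fun x => ?_)
  have : M.resolutionD 0 x ∈ LinearMap.range (M.resolutionD 0) := ⟨x, rfl⟩
  rw [range_resolutionD] at this
  exact this

/-- The free resolution of `M`. -/
def resolution (M : GradedMod 𝒜) : ProjectiveResolution M.carrier where
  complex := M.resolutionComplex
  projective n := ModuleCat.projective_of_free (M := ModuleCat.of R _) Finsupp.basisSingleOne
  π := (ChainComplex.toSingle₀Equiv _ _).symm
    ⟨M.augmentation, M.resolutionComplex_d_augmentation⟩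
  quasiIso := ⟨fun n => by
    cases n
    · rw [ChainComplex.quasiIsoAt₀_iff, ShortComplex.quasiIso_iff_of_zeros']
      · refine (ShortComplex.exact_and_epi_g_iff_of_iso
          (S₂ := ShortComplex.mk _ _ M.resolutionComplex_d_augmentation) ?_).2 ⟨?_, ?_⟩
        · refine ShortComplex.isoMk (Iso.refl _) (Iso.refl _) (Iso.refl _)
            ((Category.id_comp _).trans (Category.comp_id _).symm) ?_
          refine (Category.id_comp _).trans (Eq.trans ?_ (Category.comp_id _).symm)
          exact (ChainComplex.toSingle₀Equiv_symm_apply_f_zero _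
            M.resolutionComplex_d_augmentation).symm
        · rw [ShortComplex.moduleCat_exact_iff_range_eq_ker]
          refine Eq.trans ?_ (M.range_resolutionD 0)
          exact congrArg (fun f => LinearMap.range (ModuleCat.Hom.hom f)) (M.resolutionComplex_d 0)
        · exact (ModuleCat.epi_iff_surjective _).2 M.cover_surjective
      all_goals rfl
    · rw [quasiIsoAt_iff_exactAt']
      · apply resolutionComplex_exactAt_succ
      · apply ChainComplex.exactAt_succ_single_obj⟩

end GradedMod

variable [GradedRing 𝒜]

/-- The graded module `R ⧸ J` of a homogeneous ideal `J`. -/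
def quotientGradedMod {J : Ideal R} (hJ : J.IsHomogeneous 𝒜) : GradedMod 𝒜 where
  carrier := ModuleCat.of R (R ⧸ J)
  deg e := (intDegree 𝒜 e).map (Ideal.Quotient.mk J).toAddMonoidHom
  isGradedModule := isGradedModule_quotient hJ

/-- A graded free resolution of `R ⧸ J`. -/
def gradedResolution {J : Ideal R} (hJ : J.IsHomogeneous 𝒜) : GradedResolution 𝒜 J where
  res := (quotientGradedMod hJ).resolution
  deg n := ((quotientGradedMod hJ).iterSyzygy n).coverDegree
  isGradedModule n := ((quotientGradedMod hJ).iterSyzygy n).isGradedModule_coverDegree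
  d_mem i j e m hm := by
    by_cases h : j + 1 = i
    · subst h
      have := (quotientGradedMod hJ).hasDegree_resolutionD j e m hm
      rw [add_zero] at this
      change (quotientGradedMod hJ).resolutionComplex.d (j + 1) j m ∈ _
      rw [(quotientGradedMod hJ).resolutionComplex_d]
      exact this
    · rw [HomologicalComplex.shape _ _ _ h]
      exact zero_mem _
  aug_mem e m hm := by
    have := (quotientGradedMod hJ).hasDegree_cover e m hm
    rw [add_zero] at this
    have e1 : (quotientGradedMod hJ).resolution.π.f 0 = (quotientGradedMod hJ).augmentation :=
      ChainComplex.toSingle₀Equiv_symm_apply_f_zero _ _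
    have e2 : (quotientGradedMod hJ).resolution.π.f 0 ≫
        (HomologicalComplex.singleObjXSelf (ComplexShape.down ℕ) 0
          (ModuleCat.of R (R ⧸ J))).hom = (quotientGradedMod hJ).augmentation := by
      rw [e1]
      exact Category.comp_id _
    have e3 := congrArg (fun f => f.hom m) e2
    exact Eq.mpr (congrArg (· ∈ _) e3) this

end FreeResolution

/-! ### Koszul complexes of powers and their pro-vanishing homology -/

section Koszul

variable {K : Type*} {R : Type u} [CommRing K] [CommRing R] [Algebra K R]

/-- An inverse system, indexed by `s : ℕ`, of graded complexes of projective modules on a fixed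
family of modules, that behaves like the Koszul complexes of the powers of `r` elements: the
zeroth homology of the `s`-th complex is `R ⧸ J s`, the higher homology is pro-zero, and the last
module is free of rank one. -/
structure KoszulSystem (𝒜 : ℕ → Submodule K R) (r : ℕ) (J : ℕ → Ideal R) where
  /-- The modules. -/
  X : ℕ → ModuleCat.{u} R
  /-- The grading of the `i`-th module of the `s`-th complex. -/
  deg : ∀ _s i : ℕ, ℤ → AddSubgroup (X i)
  /-- The differentials of the `s`-th complex. -/
  d : ∀ _s i : ℕ, X (i + 1) →ₗ[R] X i
  /-- The transition map from the `t`-th complex to the `s`-th one. -/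
  tr : ∀ _s _t i : ℕ, X i →ₗ[R] X i
  /-- The augmentation. -/
  aug : X 0 ≃ₗ[R] R
  /-- The generator of the last module, in the form of a coordinate. -/
  top : X r ≃ₗ[R] R
  /-- The degree of the coordinate on the last module. -/
  topDeg : ℕ → ℤ
  projective : ∀ i, Module.Projective R (X i)
  isGradedModule : ∀ s i, IsGradedModule 𝒜 (deg s i)
  d_d : ∀ s i x, d s i (d s (i + 1) x) = 0
  tr_d : ∀ s t i x, s ≤ t → tr s t i (d t i x) = d s i (tr s t (i + 1) x)
  tr_tr : ∀ s t u i x, s ≤ t → t ≤ u → tr s t i (tr t u i x) = tr s u i x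
  aug_tr : ∀ s t x, s ≤ t → aug (tr s t 0 x) = aug x
  hasDegree_d : ∀ s i, HasDegree (deg s (i + 1)) (deg s i) (d s i) 0
  hasDegree_tr : ∀ s t i, s ≤ t → HasDegree (deg t i) (deg s i) (tr s t i) 0
  hasDegree_aug : ∀ s, HasDegree (deg s 0) (intDegree 𝒜) aug.toLinearMap 0
  hasDegree_top : ∀ s, HasDegree (deg s r) (intDegree 𝒜) top.toLinearMap (topDeg s)
  range_aug : ∀ s, (LinearMap.range (d s 0)).map aug.toLinearMap = J s
  subsingleton : ∀ i, r < i → Subsingleton (X i)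
  prozero : ∀ s i, ∃ t, s ≤ t ∧ ∀ x, d t i x = 0 → ∃ y, d s (i + 1) y = tr s t (i + 1) x

variable {𝒜 : ℕ → Submodule K R}

namespace KoszulSystem

section Base

/-- The modules of the Koszul system of no elements. -/
abbrev baseX (R : Type u) [CommRing R] : ℕ → ModuleCat.{u} R
  | 0 => ModuleCat.of R R
  | _ + 1 => ModuleCat.of R PUnit.{u + 1}

instance (i : ℕ) : Subsingleton (baseX R (i + 1)) := inferInstanceAs (Subsingleton PUnit)

/-- The grading of the Koszul system of no elements. -/
abbrev baseDeg (𝒜 : ℕ → Submodule K R) : ∀ i, ℤ → AddSubgroup (baseX R i)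
  | 0 => intDegree 𝒜
  | _ + 1 => fun _ => ⊥

lemma projective_of_subsingleton (M : Type*) [AddCommGroup M] [Module R M] [Subsingleton M] :
    Module.Projective R M :=
  ⟨0, fun _ => Subsingleton.elim _ _⟩

lemma map_range_zero {M N L : Type*} [AddCommGroup M] [Module R M] [AddCommGroup N] [Module R N]
    [AddCommGroup L] [Module R L] (e : N →ₗ[R] L) :
    (LinearMap.range (0 : M →ₗ[R] N)).map e = ⊥ := by
  rw [LinearMap.range_zero, Submodule.map_bot]

variable (𝒜) in
/-- The Koszul system of no elements. -/
def base [GradedRing 𝒜] : KoszulSystem 𝒜 0 (fun _ => ⊥) where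
  X := baseX R
  deg _ := baseDeg 𝒜
  d _ _ := 0
  tr _ _ _ := LinearMap.id
  aug := LinearEquiv.refl R R
  top := LinearEquiv.refl R R
  topDeg _ := 0
  projective i := by
    cases i
    · exact inferInstanceAs (Module.Projective R R)
    · exact projective_of_subsingleton _
  isGradedModule _ i := by
    cases i
    · exact isGradedModule_intDegree 𝒜
    · refine ⟨isInternal_of_proj (fun _ => 0) (fun _ _ _ => Subsingleton.elim _ _)
        (fun _ _ _ _ _ => rfl) ?_, fun _ _ _ _ _ _ => ?_⟩
      · rw [eq_top_iff]
        intro x _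
        rw [Subsingleton.elim x 0]
        exact zero_mem _
      · exact AddSubgroup.mem_bot.2 (Subsingleton.elim _ _)
  d_d _ _ _ := rfl
  tr_d _ _ _ _ _ := rfl
  tr_tr _ _ _ _ _ _ _ := rfl
  aug_tr _ _ _ _ := rfl
  hasDegree_d _ _ _ _ _ := zero_mem _
  hasDegree_tr _ _ _ _ j m hm := by rw [add_zero]; exact hm
  hasDegree_aug _ j m hm := by rw [add_zero]; exact hm
  hasDegree_top _ j m hm := by rw [add_zero]; exact hm
  range_aug _ := map_range_zero _
  subsingleton i hi := by
    cases i
    · omega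
    · infer_instance
  prozero s i := ⟨s, le_rfl, fun x _ => ⟨0, Subsingleton.elim _ _⟩⟩

end Base

section Cone

variable {r : ℕ} {J : ℕ → Ideal R} (C : KoszulSystem 𝒜 r J) (f : R) (δ : ℤ)

/-- The modules of the cone of multiplication by powers of `f`. -/
abbrev coneX : ℕ → ModuleCat.{u} R
  | 0 => C.X 0
  | i + 1 => ModuleCat.of R (C.X (i + 1) × C.X i)

/-- The grading of the cone of multiplication by powers of an element `f` of degree `δ`. -/
abbrev coneDeg (s : ℕ) : ∀ i, ℤ → AddSubgroup (C.coneX i)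
  | 0 => C.deg s 0
  | i + 1 => fun e => (C.deg s (i + 1) e).prod (C.deg s i (e - s * δ))

/-- The differentials of the cone of multiplication by powers of `f`. -/
def coneD (s : ℕ) : ∀ i, C.coneX (i + 1) →ₗ[R] C.coneX i
  | 0 => (C.d s 0).coprod (f ^ s • LinearMap.id)
  | i + 1 => ((C.d s (i + 1)).coprod (f ^ s • LinearMap.id)).prod
      -- The sign makes the two mixed terms `f ^ s • d b` cancel in the square of the differential.
      (-(C.d s i ∘ₗ LinearMap.snd R _ _))

/-- The transition maps of the cone of multiplication by powers of `f`. -/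
def coneTr (s t : ℕ) : ∀ i, C.coneX i →ₗ[R] C.coneX i
  | 0 => C.tr s t 0
  -- The factor `f ^ (t - s)` is what compatibility with multiplication by `f ^ t` and `f ^ s`
  -- requires.
  | i + 1 => (C.tr s t (i + 1)).prodMap (f ^ (t - s) • C.tr s t i)

variable {f δ}

lemma coneD_zero_apply (s : ℕ) (a : C.X 1) (b : C.X 0) :
    C.coneD f s 0 (a, b) = C.d s 0 a + f ^ s • b := rfl

lemma coneD_succ_apply (s i : ℕ) (a : C.X (i + 2)) (b : C.X (i + 1)) :
    C.coneD f s (i + 1) (a, b) = (C.d s (i + 1) a + f ^ s • b, -C.d s i b) := rfl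

lemma coneTr_succ_apply (s t i : ℕ) (a : C.X (i + 1)) (b : C.X i) :
    C.coneTr f s t (i + 1) (a, b) = (C.tr s t (i + 1) a, f ^ (t - s) • C.tr s t i b) := rfl

lemma coneD_coneD (s i : ℕ) (x : C.coneX (i + 2)) :
    C.coneD f s i (C.coneD f s (i + 1) x) = 0 := by
  obtain ⟨a, b⟩ := x
  rw [coneD_succ_apply]
  cases i
  · rw [coneD_zero_apply, map_add, C.d_d, map_smul, smul_neg, zero_add, add_neg_cancel]
  · rw [coneD_succ_apply, map_add, C.d_d, map_smul, smul_neg, zero_add, add_neg_cancel, map_neg,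
      C.d_d, neg_zero, neg_zero]
    rfl

lemma coneTr_coneD (s t i : ℕ) (x : C.coneX (i + 1)) (h : s ≤ t) :
    C.coneTr f s t i (C.coneD f t i x) = C.coneD f s i (C.coneTr f s t (i + 1) x) := by
  obtain ⟨a, b⟩ := x
  have hf : f ^ s * f ^ (t - s) = f ^ t := by rw [← pow_add, Nat.add_sub_cancel' h]
  cases i
  · rw [coneTr_succ_apply, coneD_zero_apply, coneD_zero_apply, smul_smul, hf, ← C.tr_d _ _ _ _ h,
      ← map_smul, ← map_add]
    rfl
  · refine Prod.ext ?_ ?_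
    · change C.tr s t _ (C.d t _ a + f ^ t • b) = C.d s _ (C.tr s t _ a) +
        f ^ s • f ^ (t - s) • C.tr s t _ b
      rw [smul_smul, hf, ← C.tr_d _ _ _ _ h, map_add, map_smul]
    · change f ^ (t - s) • C.tr s t _ (-C.d t _ b) = -C.d s _ (f ^ (t - s) • C.tr s t _ b)
      rw [map_smul, ← C.tr_d _ _ _ _ h, map_neg, smul_neg]

lemma coneTr_coneTr (s t u i : ℕ) (x : C.coneX i) (hst : s ≤ t) (htu : t ≤ u) :
    C.coneTr f s t i (C.coneTr f t u i x) = C.coneTr f s u i x := by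
  cases i
  · exact C.tr_tr s t u 0 x hst htu
  · obtain ⟨a, b⟩ := x
    refine Prod.ext (C.tr_tr _ _ _ _ _ hst htu) ?_
    change f ^ (t - s) • C.tr s t _ (f ^ (u - t) • C.tr t u _ b) = f ^ (u - s) • C.tr s u _ b
    rw [map_smul, C.tr_tr _ _ _ _ _ hst htu, smul_smul, ← pow_add]
    congr 2
    omega

lemma hasDegree_smul_pow {M : Type*} [AddCommGroup M] [Module R M] {ℳ : ℤ → AddSubgroup M}
    (hM : IsGradedModule 𝒜 ℳ) [GradedRing 𝒜] {δ : ℕ} (hf : f ∈ 𝒜 δ) (s : ℕ) {e : ℤ} {m : M}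
    (hm : m ∈ ℳ (e - s * δ)) : f ^ s • m ∈ ℳ e := by
  have := hM.smul_mem _ _ _ _ (SetLike.pow_mem_graded s hf) hm
  rwa [smul_eq_mul, Nat.cast_mul, add_sub_cancel] at this

/-- A cycle `(a, b)` of the cone is treated in two stages. Transition to a first level `t₁` makes
the second coordinate a boundary `d c`, and correcting by the cone boundary of `(0, c)` leaves a
cycle of `C`. This cycle dies in the homology of `C` on passing from `t₁` to `s`. -/
lemma cone_prozero [IsNoetherianRing R] (s i : ℕ) :
    ∃ t, s ≤ t ∧ ∀ x, C.coneD f t i x = 0 →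
      ∃ y, C.coneD f s (i + 1) y = C.coneTr f s t (i + 1) x := by
  obtain ⟨t₁, hst, h₁⟩ := C.prozero s i
  have key : ∃ t, t₁ ≤ t ∧ ∀ (a : C.X (i + 1)) (b : C.X i), C.coneD f t i (a, b) = 0 →
      ∃ c, C.d t₁ i c = f ^ (t - t₁) • C.tr t₁ t i b := by
    cases i with
    | zero =>
      -- The colon ideals `(J t₁ : f ^ m)` form an ascending chain. Once it is stable from `N` on,
      -- `f ^ (t₁ + N) * b ∈ J t₁` already gives `f ^ N * b ∈ J t₁`, where `N = t - t₁` is the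
      -- exponent in the transition map.
      let F : ℕ →o Ideal R :=
        { toFun := fun m => Submodule.comap (LinearMap.mulLeft R (f ^ m)) (J t₁)
          monotone' := monotone_nat_of_le_succ fun m x hx => by
            change f ^ (m + 1) * x ∈ J t₁
            rw [pow_succ', mul_assoc]
            exact Ideal.mul_mem_left _ _ hx }
      obtain ⟨N, hN⟩ := monotone_stabilizes_iff_noetherian.2 ‹IsNoetherianRing R› F
      refine ⟨t₁ + N, le_self_add, fun a b hab => ?_⟩
      rw [coneD_zero_apply] at hab
      have h2 : f ^ (t₁ + N) * C.aug b ∈ J t₁ := by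
        rw [← C.range_aug]
        refine ⟨_, ⟨C.tr t₁ (t₁ + N) 1 (-a), rfl⟩, ?_⟩
        rw [← C.tr_d _ _ _ _ le_self_add, map_neg (C.d (t₁ + N) 0),
          neg_eq_of_add_eq_zero_right hab]
        exact (C.aug_tr _ _ _ le_self_add).trans (by rw [map_smul, smul_eq_mul])
      have h3 : C.aug b ∈ F N := by
        rw [hN _ (Nat.le_add_left N t₁)]
        exact h2
      have h4 : f ^ N * C.aug b ∈ J t₁ := h3
      rw [← C.range_aug] at h4
      obtain ⟨_, ⟨c, rfl⟩, hc⟩ := h4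
      refine ⟨c, C.aug.injective (hc.trans ?_)⟩
      rw [Nat.add_sub_cancel_left, map_smul, C.aug_tr _ _ _ le_self_add, smul_eq_mul]
    | succ i =>
      obtain ⟨t, ht, h⟩ := C.prozero t₁ i
      refine ⟨t, ht, fun a b hab => ?_⟩
      have hb : C.d t i b = 0 := neg_eq_zero.1 (congrArg Prod.snd hab)
      obtain ⟨c, hc⟩ := h b hb
      exact ⟨f ^ (t - t₁) • c, by rw [map_smul, hc]⟩
  obtain ⟨t, ht, h⟩ := key
  refine ⟨t, hst.trans ht, ?_⟩
  rintro ⟨a, b⟩ hab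
  obtain ⟨c, hc⟩ := h a b hab
  -- This is the first coordinate of the transported cycle plus the cone boundary of `(0, c)`, which
  -- is `(f ^ t₁ • c, -d c)`.
  have hcycle : C.d t₁ i (C.tr t₁ t (i + 1) a + f ^ t₁ • c) = 0 := by
    have h1 : C.coneD f t₁ i (C.coneTr f t₁ t (i + 1) (a, b)) = 0 := by
      rw [← C.coneTr_coneD _ _ _ _ ht, hab, map_zero]
    rw [coneTr_succ_apply, ← hc] at h1
    rw [map_add, map_smul]
    cases i
    · exact h1
    · exact congrArg Prod.fst h1
  obtain ⟨z, hz⟩ := h₁ _ hcycle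
  refine ⟨(z, 0) - C.coneTr f s t₁ (i + 2) (0, c), ?_⟩
  rw [map_sub, ← C.coneTr_coneD _ _ _ _ hst, ← C.coneTr_coneTr s t₁ t _ _ hst ht]
  refine Prod.ext ?_ ?_
  · change (C.d s _ z + f ^ s • 0) - C.tr s t₁ _ (C.d t₁ _ 0 + f ^ t₁ • c) =
      C.tr s t₁ _ (C.tr t₁ t _ a)
    rw [hz, smul_zero, add_zero, map_zero, zero_add, map_add, add_sub_cancel_right]
  · change (-C.d s i 0) - f ^ (t₁ - s) • C.tr s t₁ i (-C.d t₁ i c) =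
      f ^ (t₁ - s) • C.tr s t₁ i (f ^ (t - t₁) • C.tr t₁ t i b)
    rw [← hc, map_neg, map_zero, neg_zero, smul_neg, sub_neg_eq_add, zero_add]

/-- The cone of multiplication by powers of a homogeneous element on a Koszul system. -/
def cone [IsNoetherianRing R] [GradedRing 𝒜] {δ : ℕ} (hf : f ∈ 𝒜 δ) :
    KoszulSystem 𝒜 (r + 1) fun s => J s ⊔ Ideal.span {f ^ s} where
  X := C.coneX
  deg := C.coneDeg δ
  d := C.coneD f
  tr := C.coneTr f
  aug := C.aug
  top :=
    have := C.subsingleton (r + 1) (Nat.lt_succ_self r)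
    (LinearEquiv.ofBijective (LinearMap.snd R (C.X (r + 1)) (C.X r))
      ⟨fun _ _ h => Prod.ext (Subsingleton.elim _ _) h, Prod.snd_surjective⟩).trans C.top
  topDeg s := C.topDeg s - s * δ
  projective i := by
    have := C.projective
    cases i
    · exact C.projective 0
    · exact inferInstanceAs (Module.Projective R (C.X _ × C.X _))
  isGradedModule s i := by
    cases i
    · exact C.isGradedModule s 0
    · exact (C.isGradedModule s _).prod ((C.isGradedModule s _).shift _)
  d_d := C.coneD_coneD
  tr_d := C.coneTr_coneD
  tr_tr := C.coneTr_coneTr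
  aug_tr := C.aug_tr
  hasDegree_d s i := by
    cases i
    · rintro e ⟨a, b⟩ ⟨ha, hb⟩
      have := C.hasDegree_d s 0 e a ha
      rw [add_zero] at this ⊢
      exact add_mem this (hasDegree_smul_pow (C.isGradedModule s 0) hf s hb)
    · rintro e ⟨a, b⟩ ⟨ha, hb⟩
      have h1 := C.hasDegree_d s _ e a ha
      have h2 := C.hasDegree_d s _ _ b hb
      rw [add_zero] at h1 h2 ⊢
      exact ⟨add_mem h1 (hasDegree_smul_pow (C.isGradedModule s _) hf s hb),
        (C.deg s _ (e - s * δ)).neg_mem h2⟩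
  hasDegree_tr s t i h := by
    cases i
    · exact C.hasDegree_tr s t 0 h
    · rintro e ⟨a, b⟩ ⟨ha, hb⟩
      have h1 := C.hasDegree_tr s t _ h e a ha
      have h2 := C.hasDegree_tr s t _ h _ b hb
      rw [add_zero] at h1 h2 ⊢
      refine ⟨h1, hasDegree_smul_pow (C.isGradedModule s _) hf (t - s) ?_⟩
      have e1 : e - s * δ - ((t - s : ℕ) : ℤ) * δ = e - t * δ := by
        rw [Nat.cast_sub h]; ring
      rw [e1]
      exact h2
  hasDegree_aug := C.hasDegree_aug
  hasDegree_top s := by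
    rintro e ⟨a, b⟩ ⟨ha, hb⟩
    have := C.hasDegree_top s _ b hb
    have e1 : e - s * δ + C.topDeg s = e + (C.topDeg s - s * δ) := by ring
    rw [← e1]
    exact this
  range_aug s := by
    have h1 : LinearMap.range (C.coneD f s 0) =
        LinearMap.range (C.d s 0) ⊔ LinearMap.range (f ^ s • LinearMap.id : C.X 0 →ₗ[R] C.X 0) :=
      LinearMap.range_coprod _ _
    rw [h1]
    refine (Submodule.map_sup _ _ _).trans ?_
    rw [C.range_aug]
    congr 1
    ext x
    rw [Ideal.mem_span_singleton']
    constructor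
    · rintro ⟨_, ⟨y, rfl⟩, rfl⟩
      exact ⟨C.aug y, by simp [mul_comm]⟩
    · rintro ⟨a, rfl⟩
      exact ⟨_, ⟨C.aug.symm a, rfl⟩, by simp [mul_comm]⟩
  subsingleton i hi := by
    cases i with
    | zero => omega
    | succ i =>
      have := C.subsingleton (i + 1) (by omega)
      have := C.subsingleton i (by omega)
      exact inferInstanceAs (Subsingleton (C.X _ × C.X _))
  prozero := C.cone_prozero

end Cone

/-- The Koszul complex of `r + 1` elements is the cone of multiplication by the last one on the
complex of the first `r`, so the system is built by induction from the empty family. -/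
theorem nonempty_of_homogeneous [IsNoetherianRing R] [GradedRing 𝒜] {r : ℕ} (f : Fin r → R)
    (hf : ∀ i, ∃ δ, f i ∈ 𝒜 δ) :
    Nonempty (KoszulSystem 𝒜 r fun s => Ideal.span (Set.range fun i => f i ^ s)) := by
  induction r with
  | zero =>
    have : (fun s => Ideal.span (Set.range fun i => f i ^ s)) = fun _ => ⊥ := by
      funext s
      simp
    exact this ▸ ⟨base 𝒜⟩
  | succ r ih =>
    obtain ⟨C⟩ := ih (fun i => f i.castSucc) fun i => hf _
    obtain ⟨δ, hδ⟩ := hf (Fin.last r)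
    have : (fun s => Ideal.span (Set.range fun i => f i ^ s)) = fun s =>
        Ideal.span (Set.range fun i : Fin r => f i.castSucc ^ s) ⊔
          Ideal.span {f (Fin.last r) ^ s} := by
      funext s
      rw [← Ideal.span_union]
      congr 1
      ext x
      simp only [Set.mem_range, Set.mem_union, Set.mem_singleton_iff, Fin.exists_fin_succ',
        eq_comm]
    exact this ▸ ⟨C.cone hδ⟩

end KoszulSystem

end Koszul

/-! ### Comparison maps between resolutions and Koszul complexes -/

section Lifts

variable {K : Type*} {R : Type u} [CommRing K] [CommRing R] [Algebra K R]
  {𝒜 : ℕ → Submodule K R}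

lemma exists_linearMap_comp_eq {P M N : Type*} [AddCommGroup P] [Module R P] [AddCommGroup M]
    [Module R M] [AddCommGroup N] [Module R N] [Module.Projective R P] (d : M →ₗ[R] N)
    (g : P →ₗ[R] N) (h : ∀ x, ∃ y, d y = g x) : ∃ l : P →ₗ[R] M, d ∘ₗ l = g := by
  obtain ⟨l, hl⟩ := Module.projective_lifting_property d.rangeRestrict
    (g.codRestrict (LinearMap.range d) h) d.surjective_rangeRestrict
  refine ⟨l, LinearMap.ext fun x => ?_⟩
  exact congrArg Subtype.val (LinearMap.congr_fun hl x)

/-- The augmentation of a projective resolution. -/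
def resAug {Z : ModuleCat.{u} R} (P : ProjectiveResolution Z) : P.complex.X 0 ⟶ Z :=
  P.π.f 0 ≫ (HomologicalComplex.singleObjXSelf (ComplexShape.down ℕ) 0 Z).hom

/-- The identification inserted in `resAug`, as in `GradedResolution.aug_mem`, is definitionally an
identity. -/
lemma resAug_eq {Z : ModuleCat.{u} R} (P : ProjectiveResolution Z) : resAug P = P.π.f 0 :=
  Category.comp_id _

lemma d_resAug {Z : ModuleCat.{u} R} (P : ProjectiveResolution Z) :
    P.complex.d 1 0 ≫ resAug P = 0 := by
  rw [resAug_eq]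
  exact P.complex_d_comp_π_f_zero

instance epi_resAug {Z : ModuleCat.{u} R} (P : ProjectiveResolution Z) : Epi (resAug P) := by
  rw [resAug_eq]
  exact inferInstanceAs (Epi (P.π.f 0))

/-- A chain complex of projectives maps to any resolution of an object to which it is augmented. -/
lemma exists_chainMap {Z : ModuleCat.{u} R} (C : ChainComplex (ModuleCat.{u} R) ℕ)
    (hC : ∀ i, Projective (C.X i)) (Q : ProjectiveResolution Z) (f : C.X 0 ⟶ Z)
    (hf : C.d 1 0 ≫ f = 0) : ∃ κ : C ⟶ Q.complex, κ.f 0 ≫ resAug Q = f := by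
  obtain ⟨f₀, hf₀⟩ : ∃ f₀ : C.X 0 ⟶ Q.complex.X 0, f₀ ≫ resAug Q = f :=
    ⟨_, Projective.factorThru_comp f (resAug Q)⟩
  have h₀ : (C.d 1 0 ≫ f₀) ≫ Q.π.f 0 = 0 := by
    rw [← resAug_eq Q]
    exact (Category.assoc _ _ _).trans ((congrArg (C.d 1 0 ≫ ·) hf₀).trans hf)
  let f₁ : C.X 1 ⟶ Q.complex.X 1 := Q.exact₀.liftFromProjective (C.d 1 0 ≫ f₀) h₀
  have hf₁ : f₁ ≫ Q.complex.d 1 0 = C.d 1 0 ≫ f₀ := Q.exact₀.liftFromProjective_comp _ _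
  refine ⟨ChainComplex.mkHom _ _ f₀ f₁ hf₁ fun n ⟨g, g', w⟩ =>
    ⟨(Q.exact_succ n).liftFromProjective (C.d (n + 2) (n + 1) ≫ g') (by simp [w]),
      (Q.exact_succ n).liftFromProjective_comp _ _⟩, ?_⟩
  rw [ChainComplex.mkHom_f_0, hf₀]

instance moduleProjective_of_resolution {Z : ModuleCat.{u} R} (P : ProjectiveResolution Z) (i : ℕ) :
    Module.Projective R (P.complex.X i) :=
  (IsProjective.iff_projective _).2 (P.projective i)

namespace KoszulSystem

variable {r : ℕ} {J : ℕ → Ideal R} (C : KoszulSystem 𝒜 r J)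

include C in
lemma antitone : Antitone J := by
  intro s t h
  rw [← C.range_aug s, ← C.range_aug t]
  rintro _ ⟨_, ⟨x, rfl⟩, rfl⟩
  exact ⟨_, ⟨C.tr s t 1 x, rfl⟩, by
    rw [← C.tr_d _ _ _ _ h]; exact C.aug_tr _ _ _ h⟩

/-- The `s`-th complex of a Koszul system. -/
def complex (s : ℕ) : ChainComplex (ModuleCat.{u} R) ℕ :=
  ChainComplex.of C.X (fun i => ModuleCat.ofHom (C.d s i)) fun i =>
    ModuleCat.hom_ext (LinearMap.ext fun x => C.d_d s i x)

lemma complex_d (s i : ℕ) : (C.complex s).d (i + 1) i = ModuleCat.ofHom (C.d s i) :=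
  ChainComplex.of_d C.X (fun i => ModuleCat.ofHom (C.d s i)) i

/-- The augmentation of the `s`-th complex of a Koszul system to `R ⧸ L`. -/
def complexAug (s : ℕ) (L : Ideal R) : (C.complex s).X 0 ⟶ ModuleCat.of R (R ⧸ L) :=
  ModuleCat.ofHom (L.mkQ ∘ₗ C.aug.toLinearMap)

lemma complex_d_complexAug {s : ℕ} {L : Ideal R} (h : J s ≤ L) :
    (C.complex s).d 1 0 ≫ C.complexAug s L = 0 := by
  rw [complex_d]
  refine ModuleCat.hom_ext (LinearMap.ext fun x => ?_)
  change L.mkQ (C.aug (C.d s 0 x)) = 0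
  rw [Submodule.mkQ_apply, Submodule.Quotient.mk_eq_zero]
  refine h ?_
  rw [← C.range_aug]
  exact ⟨_, ⟨x, rfl⟩, rfl⟩

lemma exists_chainMap_to_resolution {s : ℕ} {L : Ideal R} (h : J s ≤ L)
    (P : ProjectiveResolution (ModuleCat.of R (R ⧸ L))) :
    ∃ κ : C.complex s ⟶ P.complex, κ.f 0 ≫ resAug P = C.complexAug s L :=
  exists_chainMap _ (fun i => (IsProjective.iff_projective _).1 (C.projective i)) P _
    (C.complex_d_complexAug h)

/-- Lifting past a positive degree requires cycles to be boundaries, which holds only after a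
transition from a later level `s₁` to `s`. Each such step therefore starts from a lift to level
`s₁`. In degree zero no such loss occurs: the obstruction lies in `J t ≤ J s`, the image of the
first differential. The index `t` is chosen before the resolution `P`. -/
lemma exists_partial_lift (n s : ℕ) :
    ∃ t, s ≤ t ∧ ∀ P : ProjectiveResolution (ModuleCat.of R (R ⧸ J t)),
      ∃ l : ∀ i, P.complex.X i →ₗ[R] C.X i,
        (J t).mkQ ∘ₗ C.aug.toLinearMap ∘ₗ l 0 = (resAug P).hom ∧
        ∀ i < n, C.d s i ∘ₗ l (i + 1) = l i ∘ₗ (P.complex.d (i + 1) i).hom := by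
  induction n generalizing s with
  | zero =>
    refine ⟨s, le_rfl, fun P => ?_⟩
    obtain ⟨l, hl⟩ := exists_linearMap_comp_eq ((J s).mkQ ∘ₗ C.aug.toLinearMap) (resAug P).hom
      fun x => (Submodule.mkQ_surjective _).comp C.aug.surjective _
    refine ⟨fun i => match i with
      | 0 => l
      | _ + 1 => 0, hl, fun i hi => absurd hi (Nat.not_lt_zero i)⟩
  | succ n ih =>
    have key : ∃ s₁, s ≤ s₁ ∧ ∃ t, s₁ ≤ t ∧
        ∀ P : ProjectiveResolution (ModuleCat.of R (R ⧸ J t)),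
        ∃ l : ∀ i, P.complex.X i →ₗ[R] C.X i,
          (J t).mkQ ∘ₗ C.aug.toLinearMap ∘ₗ l 0 = (resAug P).hom ∧
          (∀ i < n, C.d s₁ i ∘ₗ l (i + 1) = l i ∘ₗ (P.complex.d (i + 1) i).hom) ∧
          ∀ x, ∃ y, C.d s n y = C.tr s s₁ n (l n (P.complex.d (n + 1) n x)) := by
      cases n with
      | zero =>
        obtain ⟨t, hst, ht⟩ := ih s
        refine ⟨s, le_rfl, t, hst, fun P => ?_⟩
        obtain ⟨l, hl, hl'⟩ := ht P
        refine ⟨l, hl, hl', fun x => ?_⟩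
        have h0 : (J t).mkQ (C.aug (l 0 (P.complex.d 1 0 x))) = 0 :=
          (LinearMap.congr_fun hl (P.complex.d 1 0 x)).trans
            (congrArg (fun f => f.hom x) (d_resAug P))
        rw [Submodule.mkQ_apply, Submodule.Quotient.mk_eq_zero] at h0
        have h1 := C.antitone hst h0
        rw [← C.range_aug s] at h1
        obtain ⟨_, ⟨y, rfl⟩, hy⟩ := h1
        exact ⟨y, C.aug.injective (hy.trans (C.aug_tr _ _ _ le_rfl).symm)⟩
      | succ n =>
        obtain ⟨s₁, hs, hpro⟩ := C.prozero s n
        obtain ⟨t, hst, ht⟩ := ih s₁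
        refine ⟨s₁, hs, t, hst, fun P => ?_⟩
        obtain ⟨l, hl, hl'⟩ := ht P
        refine ⟨l, hl, hl', fun x => hpro _ ?_⟩
        refine (LinearMap.congr_fun (hl' n (Nat.lt_succ_self n)) _).trans ?_
        have := congrArg (fun f => f.hom x) (P.complex.d_comp_d (n + 2) (n + 1) n)
        exact (congrArg (l n) this).trans (map_zero _)
    obtain ⟨s₁, hs, t, hst, ht⟩ := key
    refine ⟨t, hs.trans hst, fun P => ?_⟩
    obtain ⟨l, hl, hl', hx⟩ := ht P
    obtain ⟨ψ, hψ⟩ := exists_linearMap_comp_eq (C.d s n)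
      (C.tr s s₁ n ∘ₗ l n ∘ₗ (P.complex.d (n + 1) n).hom) hx
    -- The lift to level `s₁` is pushed to level `s`, and its component in degree `n + 1` is
    -- replaced by the new one.
    refine ⟨Function.update (fun i => C.tr s s₁ i ∘ₗ l i) (n + 1) ψ, ?_, fun i hi => ?_⟩
    · rw [Function.update_of_ne (by omega), ← hl]
      refine LinearMap.ext fun x => ?_
      exact congrArg (J t).mkQ (C.aug_tr _ _ _ hs)
    · rw [Function.update_of_ne (a := i) (by omega)]
      rcases Nat.lt_succ_iff_lt_or_eq.1 hi with hi | rfl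
      · rw [Function.update_of_ne (by omega)]
        refine LinearMap.ext fun x => ?_
        refine (C.tr_d _ _ _ _ hs).symm.trans ?_
        exact congrArg (C.tr s s₁ i) (LinearMap.congr_fun (hl' i hi) x)
      · rw [Function.update_self, hψ]
        rfl

/-- Finitely many steps suffice, since the Koszul modules vanish above degree `r` and the remaining
identities take values in zero modules. -/
lemma exists_lift (s : ℕ) :
    ∃ t, s ≤ t ∧ ∀ P : ProjectiveResolution (ModuleCat.of R (R ⧸ J t)),
      ∃ l : ∀ i, P.complex.X i →ₗ[R] C.X i,
        (J t).mkQ ∘ₗ C.aug.toLinearMap ∘ₗ l 0 = (resAug P).hom ∧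
        ∀ i, C.d s i ∘ₗ l (i + 1) = l i ∘ₗ (P.complex.d (i + 1) i).hom := by
  obtain ⟨t, hst, ht⟩ := C.exists_partial_lift (r + 1) s
  refine ⟨t, hst, fun P => ?_⟩
  obtain ⟨l, hl, hl'⟩ := ht P
  refine ⟨l, hl, fun i => ?_⟩
  by_cases hi : i < r + 1
  · exact hl' i hi
  · have := C.subsingleton i (by omega)
    exact LinearMap.ext fun x => Subsingleton.elim _ _

end KoszulSystem

lemma GradedResolution.hasDegree_d {J : Ideal R} (P : GradedResolution 𝒜 J) (i j : ℕ) :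
    HasDegree (P.deg i) (P.deg j) (P.res.complex.d i j).hom 0 := fun e m hm => by
  rw [add_zero]; exact P.d_mem i j e m hm

lemma GradedResolution.hasDegree_resAug {J : Ideal R} (P : GradedResolution 𝒜 J) :
    HasDegree (P.deg 0) (fun e => (intDegree 𝒜 e).map (Ideal.Quotient.mk J).toAddMonoidHom)
      (resAug P.res).hom 0 := fun e m hm => by
  rw [add_zero]; exact P.aug_mem e m hm

variable [GradedRing 𝒜]

/-- The differentials and augmentations have degree zero, so the degree zero part of any lift is
again a lift. -/
lemma KoszulSystem.exists_gradedChainMap_from_resolution {r : ℕ} {J : ℕ → Ideal R}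
    (C : KoszulSystem 𝒜 r J) (hJ : ∀ s, (J s).IsHomogeneous 𝒜) (s : ℕ) :
    ∃ t, s ≤ t ∧ ∀ P : GradedResolution 𝒜 (J t),
      ∃ l : P.res.complex ⟶ C.complex s, l.f 0 ≫ C.complexAug s (J t) = resAug P.res ∧
        ∀ i, HasDegree (P.deg i) (C.deg s i) (l.f i).hom 0 := by
  obtain ⟨t, hst, ht⟩ := C.exists_lift s
  refine ⟨t, hst, fun P => ?_⟩
  obtain ⟨l, hl, hl'⟩ := ht P.res
  let l' : ∀ i, P.res.complex.X i →ₗ[R] C.X i := fun i =>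
    degreePart (P.isGradedModule i) (C.isGradedModule s i) (l i) 0
  refine ⟨{ f := fun i => ModuleCat.ofHom (l' i), comm' := ?_ }, ?_, fun i =>
    hasDegree_degreePart (P.isGradedModule i) (C.isGradedModule s i) (l i) 0⟩
  · rintro i j hij
    obtain rfl : j + 1 = i := hij
    rw [C.complex_d]
    refine ModuleCat.hom_ext ?_
    change C.d s j ∘ₗ l' (j + 1) = l' j ∘ₗ (P.res.complex.d (j + 1) j).hom
    rw [← degreePart_comp_right _ _ (P.isGradedModule (j + 1)) (P.hasDegree_d (j + 1) j),
      ← degreePart_comp_left _ _ (C.isGradedModule s j) (C.hasDegree_d s j), hl']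
  · refine ModuleCat.hom_ext ?_
    have hq := isGradedModule_quotient (hJ t)
    have h1 : HasDegree (C.deg s 0) (fun e => (intDegree 𝒜 e).map
        (Ideal.Quotient.mk (J t)).toAddMonoidHom) ((J t).mkQ ∘ₗ C.aug.toLinearMap) 0 := by
      intro e m hm
      exact ⟨C.aug m, C.hasDegree_aug s e m hm, rfl⟩
    have h2 := P.hasDegree_resAug.degreePart_eq (P.isGradedModule 0) hq 0
    rw [if_pos rfl] at h2
    change ((J t).mkQ ∘ₗ C.aug.toLinearMap) ∘ₗ l' 0 = (resAug P.res).hom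
    rw [← degreePart_comp_left _ _ hq h1, LinearMap.comp_assoc, hl, h2]

lemma GradedResolution.exists_gradedChainMap {J' J : Ideal R} (h : J' ≤ J)
    (hJ : J.IsHomogeneous 𝒜) (P' : GradedResolution 𝒜 J') (P : GradedResolution 𝒜 J) :
    ∃ κ : P'.res.complex ⟶ P.res.complex,
      κ.f 0 ≫ resAug P.res = resAug P'.res ≫ quotientMap h ∧
        ∀ i, HasDegree (P'.deg i) (P.deg i) (κ.f i).hom 0 := by
  obtain ⟨l, hl⟩ := exists_chainMap P'.res.complex P'.res.projective P.res
    (resAug P'.res ≫ quotientMap h) (by rw [← Category.assoc, d_resAug, Limits.zero_comp])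
  let l' : ∀ i, P'.res.complex.X i →ₗ[R] P.res.complex.X i := fun i =>
    degreePart (P'.isGradedModule i) (P.isGradedModule i) (l.f i).hom 0
  refine ⟨{ f := fun i => ModuleCat.ofHom (l' i), comm' := ?_ }, ?_, fun i =>
    hasDegree_degreePart (P'.isGradedModule i) (P.isGradedModule i) (l.f i).hom 0⟩
  · rintro i j -
    refine ModuleCat.hom_ext ?_
    change (P.res.complex.d i j).hom ∘ₗ l' i = l' j ∘ₗ (P'.res.complex.d i j).hom
    rw [← degreePart_comp_right _ _ (P'.isGradedModule i) (P'.hasDegree_d i j),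
      ← degreePart_comp_left _ _ (P.isGradedModule j) (P.hasDegree_d i j)]
    exact congrArg (fun f => degreePart _ _ (ModuleCat.Hom.hom f) 0) (l.comm i j)
  · refine ModuleCat.hom_ext ?_
    have hq := isGradedModule_quotient hJ
    have h1 : HasDegree (P'.deg 0) (fun e => (intDegree 𝒜 e).map
        (Ideal.Quotient.mk J).toAddMonoidHom) (resAug P'.res ≫ quotientMap h).hom 0 := by
      intro e m hm
      obtain ⟨a, ha, ha'⟩ := P'.hasDegree_resAug e m hm
      exact ⟨a, ha, congrArg (quotientMap h).hom ha'⟩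
    have h2 := h1.degreePart_eq (P'.isGradedModule 0) hq 0
    rw [if_pos rfl] at h2
    change (resAug P.res).hom ∘ₗ l' 0 = (resAug P'.res ≫ quotientMap h).hom
    rw [← degreePart_comp_left _ _ hq P.hasDegree_resAug, ← h2, ← hl]
    rfl

end Lifts

/-! ### A criterion for a family of subgroups to be a grading -/

section GradedModules

variable {K R M : Type*} [CommRing K] [CommRing R] [Algebra K R] [AddCommGroup M] [Module R M]
  {𝒜 : ℕ → Submodule K R} [GradedRing 𝒜] {ℳ : ℤ → AddSubgroup M}

/-- Under the third hypothesis, splitting the scalar `a` into homogeneous components writes `a • m`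
as a sum of homogeneous elements. -/
lemma isGradedModule_of_independent
    (smul_mem : ∀ (d : ℕ) (e : ℤ) (a : R) (m : M), a ∈ 𝒜 d → m ∈ ℳ e → a • m ∈ ℳ (d + e))
    (independent : ∀ (S : Finset ℤ) (y : ℤ → M), (∀ e ∈ S, y e ∈ ℳ e) → ∑ e ∈ S, y e = 0 →
      ∀ e ∈ S, y e = 0)
    (span : ∀ y : M, ∃ (a : R) (e : ℤ) (m : M), m ∈ ℳ e ∧ y = a • m) :
    IsGradedModule 𝒜 ℳ where
  isInternal := by
    classical
    refine ⟨(injective_iff_map_eq_zero _).2 fun x hx => ?_,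
      coeAddMonoidHom_surjective (eq_top_iff.2 fun y _ => ?_)⟩
    · rw [DirectSum.coeAddMonoidHom_eq_dfinsuppSum] at hx
      have h := independent (DFinsupp.support x) (fun e => (x e : M)) (fun e _ => (x e).2) hx
      refine DFinsupp.ext fun e => Subtype.ext ?_
      by_cases he : e ∈ DFinsupp.support x
      · exact h e he
      · exact congrArg Subtype.val (DFinsupp.notMem_support_iff.1 he)
    · obtain ⟨a, e, m, hm, rfl⟩ := span y
      induction a using DirectSum.Decomposition.inductionOn 𝒜 with
      | zero => rw [zero_smul]; exact zero_mem _
      | @homogeneous d a =>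
        exact AddSubgroup.mem_iSup_of_mem _ (smul_mem d e a m a.2 hm)
      | add a b ha hb => rw [add_smul]; exact add_mem (ha trivial) (hb trivial)
  smul_mem := smul_mem

end GradedModules

/-! ### Cocycles representing elements of local cohomology -/

section CocycleClasses

open localCohomology

variable {R : Type u} [CommRing R] [IsNoetherianRing R] {I : Ideal R} {i : ℕ}

/-- The element `y` of `H^i_I(R)` is the image of the class of the cocycle `φ` on the resolution
`P` of `R ⧸ J`. -/
def IsClassOf (J : SelfLERadical I) (P : ProjectiveResolution (ModuleCat.of R (R ⧸ J.obj)))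
    (φ : P.complex.X i ⟶ ModuleCat.of R R) (y : (localCohomology I i).obj (ModuleCat.of R R)) :
    Prop :=
  ∃ x, Represents P i φ x ∧ extToLocalCohomology I i J x = y

variable {J J' : SelfLERadical I} {P : ProjectiveResolution (ModuleCat.of R (R ⧸ J.obj))}
  {P' : ProjectiveResolution (ModuleCat.of R (R ⧸ J'.obj))}
  {φ ψ : P.complex.X i ⟶ ModuleCat.of R R}
  {y z : (localCohomology I i).obj (ModuleCat.of R R)}

lemma IsClassOf.add (hy : IsClassOf J P φ y) (hz : IsClassOf J P ψ z) :
    IsClassOf J P (φ + ψ) (y + z) := by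
  obtain ⟨x, hx, rfl⟩ := hy
  obtain ⟨w, hw, rfl⟩ := hz
  exact ⟨x + w, hx.add hw, map_add _ _ _⟩

lemma IsClassOf.smul (hy : IsClassOf J P φ y) (a : R) : IsClassOf J P (a • φ) (a • y) := by
  obtain ⟨x, hx, rfl⟩ := hy
  exact ⟨a • x, hx.smul a, map_smul _ _ _⟩

lemma isClassOf_zero : IsClassOf J P (0 : P.complex.X i ⟶ ModuleCat.of R R) 0 :=
  ⟨0, represents_zero, map_zero _⟩

lemma IsClassOf.sum {ι : Type*} (s : Finset ι) {φ : ι → (P.complex.X i ⟶ ModuleCat.of R R)}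
    {y : ι → (localCohomology I i).obj (ModuleCat.of R R)}
    (h : ∀ j ∈ s, IsClassOf J P (φ j) (y j)) :
    IsClassOf J P (∑ j ∈ s, φ j) (∑ j ∈ s, y j) := by
  classical
  induction s using Finset.induction_on with
  | empty => exact isClassOf_zero
  | insert a s ha ih =>
    rw [Finset.sum_insert ha, Finset.sum_insert ha]
    exact (h a (Finset.mem_insert_self _ _)).add
      (ih fun j hj => h j (Finset.mem_insert_of_mem hj))

lemma IsClassOf.unique (hy : IsClassOf J P φ y) (hz : IsClassOf J P φ z) : y = z := by
  obtain ⟨x, hx, rfl⟩ := hy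
  obtain ⟨w, hw, rfl⟩ := hz
  rw [hx.unique hw]

lemma exists_isClassOf (hφ : P.complex.d (i + 1) i ≫ φ = 0) : ∃ y, IsClassOf J P φ y := by
  obtain ⟨x, hx⟩ := exists_represents_cocycle P i φ hφ
  exact ⟨_, x, hx, rfl⟩

lemma IsClassOf.eq_zero_of_coboundary (hy : IsClassOf J P φ y)
    (h : ∃ ψ : P.complex.X ((ComplexShape.up ℕ).prev i) ⟶ ModuleCat.of R R,
      φ = P.complex.d i ((ComplexShape.up ℕ).prev i) ≫ ψ) : y = 0 := by
  obtain ⟨x, hx, rfl⟩ := hy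
  rw [hx.eq_zero_iff.2 h, map_zero]

lemma IsClassOf.restrict (hy : IsClassOf J P φ y) (h : J'.obj ≤ J.obj)
    (κ : P'.complex ⟶ P.complex) (comm : κ.f 0 ≫ resAug P = resAug P' ≫ quotientMap h) :
    IsClassOf J' P' (κ.f i ≫ φ) y := by
  obtain ⟨x, hx, rfl⟩ := hy
  rw [resAug_eq, resAug_eq] at comm
  exact ⟨_, hx.map κ comm, extToLocalCohomology_restrict h x⟩

omit [IsNoetherianRing R] in
lemma extRestrict_extRestrict {L L' L'' : Ideal R} (h : L' ≤ L) (h' : L'' ≤ L') (x) :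
    extRestrict i h' (extRestrict i h x) = extRestrict i (h'.trans h) x := by
  have h1 : quotientMap h' ≫ quotientMap h = quotientMap (h'.trans h) := by
    refine ModuleCat.hom_ext (LinearMap.ext fun x => ?_)
    obtain ⟨a, rfl⟩ := Submodule.mkQ_surjective _ x
    rfl
  simp only [extRestrict]
  rw [← h1, op_comp, Functor.map_comp]
  rfl

/-- A class that is zero in the filtered colimit vanishes at some `J'`, hence at every smaller
ideal; the latter form allows passage to a cofinal sequence. -/
lemma IsClassOf.exists_coboundary (hy : IsClassOf J P φ 0) :
    ∃ J' : SelfLERadical I, ∀ J'' : SelfLERadical I, J''.obj ≤ J'.obj →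
      ∀ (h : J''.obj ≤ J.obj) (P'' : ProjectiveResolution (ModuleCat.of R (R ⧸ J''.obj)))
        (κ : P''.complex ⟶ P.complex) (_ : κ.f 0 ≫ resAug P = resAug P'' ≫ quotientMap h),
        ∃ ψ : P''.complex.X ((ComplexShape.up ℕ).prev i) ⟶ ModuleCat.of R R,
          κ.f i ≫ φ = P''.complex.d i ((ComplexShape.up ℕ).prev i) ≫ ψ := by
  obtain ⟨x, hx, hx0⟩ := hy
  obtain ⟨J', h', h0⟩ := extToLocalCohomology_eq_zero hx0
  refine ⟨J', fun J'' h'' h P'' κ comm => ?_⟩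
  rw [resAug_eq, resAug_eq] at comm
  have h1 : extRestrict i h x = 0 := by
    rw [← extRestrict_extRestrict h' h'', h0, map_zero]
  exact (hx.map κ comm).eq_zero_iff.1 h1

lemma exists_isClassOf_eq (y : (localCohomology I i).obj (ModuleCat.of R R)) :
    ∃ J : SelfLERadical I, ∀ P : ProjectiveResolution (ModuleCat.of R (R ⧸ J.obj)),
      ∃ φ, IsClassOf J P φ y := by
  obtain ⟨J, x, hx⟩ := exists_extToLocalCohomology_eq y
  refine ⟨J, fun P => ?_⟩
  obtain ⟨φ, hφ⟩ := exists_represents_class P i x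
  exact ⟨φ, x, hφ, hx⟩

end CocycleClasses

/-! ### The grading on local cohomology and the chain of generators -/

section Main

open localCohomology

variable {K : Type*} {R : Type u} [CommRing K] [CommRing R] [Algebra K R] [IsNoetherianRing R]
  {𝒜 : ℕ → Submodule K R} {I : Ideal R} {i : ℕ}

lemma mem_localCohomologyDegree [GradedRing 𝒜] {e : ℤ} {J : SelfLERadical I}
    (hJ : J.obj.IsHomogeneous 𝒜) (P : GradedResolution 𝒜 J.obj)
    {φ : P.res.complex.X i ⟶ ModuleCat.of R R}
    (hφ : HasDegree (P.deg i) (intDegree 𝒜) φ.hom e)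
    {y : (localCohomology I i).obj (ModuleCat.of R R)} (h : IsClassOf J P.res φ y) :
    y ∈ localCohomologyDegree 𝒜 I i e := by
  obtain ⟨x, ⟨z, hz, hx⟩, rfl⟩ := h
  exact AddSubgroup.subset_closure ⟨J, hJ, x, ⟨P, z, φ, hz, hφ, hx⟩, rfl⟩

lemma smul_mem_localCohomologyDegree [GradedRing 𝒜] (d : ℕ) (e : ℤ) (a : R)
    (y : (localCohomology I i).obj (ModuleCat.of R R)) (ha : a ∈ 𝒜 d)
    (hy : y ∈ localCohomologyDegree 𝒜 I i e) :
    a • y ∈ localCohomologyDegree 𝒜 I i (d + e) := by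
  induction hy using AddSubgroup.closure_induction with
  | mem y hy =>
    obtain ⟨J, hJ, x, ⟨P, z, φ, hz, hφ, hx⟩, rfl⟩ := hy
    refine mem_localCohomologyDegree hJ P (φ := a • φ) (fun j m hm => ?_)
      (IsClassOf.smul ⟨x, ⟨z, hz, hx⟩, rfl⟩ a)
    have := (isGradedModule_intDegree 𝒜).smul_mem d _ a _ ha (hφ j m hm)
    rw [show (d : ℤ) + (j + e) = j + (d + e) by ring] at this
    exact this
  | zero => rw [smul_zero]; exact zero_mem _
  | add x y _ _ hx hy => rw [smul_add]; exact add_mem hx hy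
  | neg x _ hx => rw [smul_neg]; exact neg_mem hx

variable [GradedRing 𝒜] {J : ℕ → SelfLERadical I} (hanti : Antitone fun s => (J s).obj)
  (hJ : ∀ s, (J s).obj.IsHomogeneous 𝒜)
  (hcof : ∀ L : SelfLERadical I, ∃ s, (J s).obj ≤ L.obj)

include hanti hcof in
-- Homogeneous classes may come from different ideals and resolutions. Comparison maps of degree
-- zero move them to one chosen resolution of `R ⧸ J s`; having this for all large `s` lets sums be
-- formed at a common index.
lemma exists_homogeneous_cocycle {e : ℤ} {y : (localCohomology I i).obj (ModuleCat.of R R)}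
    (hy : y ∈ localCohomologyDegree 𝒜 I i e) :
    ∃ s₀, ∀ s, s₀ ≤ s → ∃ φ : (gradedResolution (hJ s)).res.complex.X i ⟶ ModuleCat.of R R,
      HasDegree ((gradedResolution (hJ s)).deg i) (intDegree 𝒜) φ.hom e ∧
      IsClassOf (J s) (gradedResolution (hJ s)).res φ y := by
  induction hy using AddSubgroup.closure_induction with
  | mem y hy =>
    obtain ⟨L, hL, x, ⟨P, z, φ, hz, hφ, hx⟩, rfl⟩ := hy
    obtain ⟨s₀, hs₀⟩ := hcof L
    refine ⟨s₀, fun s hs => ?_⟩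
    have hle : (J s).obj ≤ L.obj := (hanti hs).trans hs₀
    obtain ⟨κ, comm, hκ⟩ := GradedResolution.exists_gradedChainMap hle hL
      (gradedResolution (hJ s)) P
    refine ⟨κ.f i ≫ φ, fun j m hm => ?_, IsClassOf.restrict ⟨x, ⟨z, hz, hx⟩, rfl⟩ hle κ comm⟩
    have := hφ _ _ (hκ i j m hm)
    rw [add_zero] at this
    exact this
  | zero => exact ⟨0, fun s _ => ⟨0, fun _ _ _ => zero_mem _, isClassOf_zero⟩⟩
  | add x y _ _ hx hy =>
    obtain ⟨s₁, h₁⟩ := hx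
    obtain ⟨s₂, h₂⟩ := hy
    refine ⟨max s₁ s₂, fun s hs => ?_⟩
    obtain ⟨φ, hφ, hφ'⟩ := h₁ s ((le_max_left _ _).trans hs)
    obtain ⟨ψ, hψ, hψ'⟩ := h₂ s ((le_max_right _ _).trans hs)
    exact ⟨φ + ψ, fun j m hm => add_mem (hφ j m hm) (hψ j m hm), hφ'.add hψ'⟩
  | neg x _ hx =>
    obtain ⟨s₁, h₁⟩ := hx
    refine ⟨s₁, fun s hs => ?_⟩
    obtain ⟨φ, hφ, hφ'⟩ := h₁ s hs
    refine ⟨(-1 : R) • φ, fun j m hm => ?_, ?_⟩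
    · have := neg_mem (hφ j m hm)
      rw [← neg_one_smul R] at this
      exact this
    · have := hφ'.smul (-1 : R)
      rwa [neg_one_smul R x] at this

include hanti hJ hcof in
lemma localCohomologyDegree_independent (S : Finset ℤ)
    (y : ℤ → (localCohomology I i).obj (ModuleCat.of R R))
    (hy : ∀ e ∈ S, y e ∈ localCohomologyDegree 𝒜 I i e) (hsum : ∑ e ∈ S, y e = 0) :
    ∀ e ∈ S, y e = 0 := by
  have h1 : ∃ s, ∀ e ∈ S, ∃ φ : (gradedResolution (hJ s)).res.complex.X i ⟶ ModuleCat.of R R,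
      HasDegree ((gradedResolution (hJ s)).deg i) (intDegree 𝒜) φ.hom e ∧
      IsClassOf (J s) (gradedResolution (hJ s)).res φ (y e) := by
    choose! s₀ hs₀ using fun e he => exists_homogeneous_cocycle hanti hJ hcof (hy e he)
    exact ⟨S.sup s₀, fun e he => hs₀ e he _ (Finset.le_sup he)⟩
  obtain ⟨s, hs⟩ := h1
  choose! φ hφ hφ' using hs
  have h2 := IsClassOf.sum S hφ'
  rw [hsum] at h2
  obtain ⟨J', hJ'⟩ := h2.exists_coboundary
  obtain ⟨t₀, ht₀⟩ := hcof J'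
  have hle : (J (max s t₀)).obj ≤ (J s).obj := hanti (le_max_left _ _)
  let Q := gradedResolution (hJ (max s t₀))
  obtain ⟨κ, comm, hκ⟩ := GradedResolution.exists_gradedChainMap hle (hJ s) Q
    (gradedResolution (hJ s))
  obtain ⟨ψ, hψ⟩ := hJ' (J (max s t₀)) ((hanti (le_max_right _ _)).trans ht₀) hle Q.res κ comm
  intro e he
  refine ((hφ' e he).restrict hle κ comm).eq_zero_of_coboundary ?_
  have hR := isGradedModule_intDegree 𝒜
  -- The cochain `ψ` bounds the sum of the restricted cocycles. As the differential has degree zero,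
  -- its degree `e` part bounds the degree `e` part of that sum, which is the single term for `e`.
  refine ⟨ModuleCat.ofHom (degreePart (Q.isGradedModule _) hR ψ.hom e), ModuleCat.hom_ext ?_⟩
  change (φ e).hom ∘ₗ (κ.f i).hom =
    degreePart (Q.isGradedModule ((ComplexShape.up ℕ).prev i)) hR ψ.hom e ∘ₗ
      (Q.res.complex.d i ((ComplexShape.up ℕ).prev i)).hom
  rw [← degreePart_comp_right _ _ (Q.isGradedModule i) (Q.hasDegree_d i _)]
  have h3 : ψ.hom ∘ₗ (Q.res.complex.d i ((ComplexShape.up ℕ).prev i)).hom =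
      ∑ e ∈ S, (φ e).hom ∘ₗ (κ.f i).hom := by
    refine (congrArg ModuleCat.Hom.hom hψ).symm.trans ?_
    rw [Preadditive.comp_sum, ModuleCat.hom_sum]
    rfl
  have h4 : ∀ d ∈ S, HasDegree (Q.deg i) (intDegree 𝒜) ((φ d).hom ∘ₗ (κ.f i).hom) d := by
    intro d hd j m hm
    have := hφ d hd _ _ (hκ i j m hm)
    rw [add_zero] at this
    exact this
  rw [h3, degreePart_sum, Finset.sum_congr rfl fun d hd => (h4 d hd).degreePart_eq _ hR e,
    Finset.sum_ite_eq' S e, if_pos he]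

include hanti hJ hcof in
lemma isGradedModule_localCohomologyDegree
    (span : ∀ y : (localCohomology I i).obj (ModuleCat.of R R), ∃ (a : R) (e : ℤ) (m : _),
      m ∈ localCohomologyDegree 𝒜 I i e ∧ y = a • m) :
    IsGradedModule 𝒜 (localCohomologyDegree 𝒜 I i) :=
  isGradedModule_of_independent smul_mem_localCohomologyDegree
    (localCohomologyDegree_independent hanti hJ hcof) span

include hJ in
/-- The classes on ideals containing `J s` are multiples of a single homogeneous class. -/
lemma exists_homogeneous_generator {r : ℕ} (C : KoszulSystem 𝒜 r fun s => (J s).obj) (s : ℕ) :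
    ∃ t, s ≤ t ∧ ∃ m : (localCohomology I r).obj (ModuleCat.of R R),
      (∃ e, m ∈ localCohomologyDegree 𝒜 I r e) ∧
      (∃ (P : ProjectiveResolution (ModuleCat.of R (R ⧸ (J t).obj))) (φ : _),
        IsClassOf (J t) P φ m) ∧
      ∀ (L : SelfLERadical I) (_ : (J s).obj ≤ L.obj)
        (P : ProjectiveResolution (ModuleCat.of R (R ⧸ L.obj))) (φ : _) (y : _),
        IsClassOf L P φ y → ∃ a : R, y = a • m := by
  obtain ⟨t, hst, ht⟩ := C.exists_gradedChainMap_from_resolution hJ s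
  let Q := gradedResolution (hJ t)
  obtain ⟨l, hl, hdeg⟩ := ht Q
  let μ : Q.res.complex.X r ⟶ ModuleCat.of R R :=
    l.f r ≫ ModuleCat.ofHom (X := C.X r) C.top.toLinearMap
  -- The composite with the differential passes through the Koszul module in degree `r + 1`, which
  -- is zero.
  have hμ : Q.res.complex.d (r + 1) r ≫ μ = 0 := by
    have h1 : Q.res.complex.d (r + 1) r ≫ l.f r = 0 := by
      rw [← l.comm]
      have := C.subsingleton (r + 1) (Nat.lt_succ_self r)
      refine ModuleCat.hom_ext (LinearMap.ext fun x => ?_)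
      have h2 : (l.f (r + 1)).hom x = 0 := Subsingleton.elim (α := C.X (r + 1)) _ _
      exact (congrArg ((C.complex s).d (r + 1) r).hom h2).trans (map_zero _)
    exact (Category.assoc _ _ _).symm.trans
      ((congrArg (· ≫ ModuleCat.ofHom (X := C.X r) C.top.toLinearMap) h1).trans Limits.zero_comp)
  obtain ⟨m, hm⟩ := exists_isClassOf (J := J t) hμ
  refine ⟨t, hst, m, ⟨C.topDeg s, mem_localCohomologyDegree (hJ t) Q (fun j x hx => ?_) hm⟩,
    ⟨Q.res, μ, hm⟩, fun L hL P φ y hy => ?_⟩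
  · have := C.hasDegree_top s _ _ (hdeg r j x hx)
    rw [add_zero] at this
    exact this
  · obtain ⟨κ, hκ⟩ := C.exists_chainMap_to_resolution hL P
    -- In the coordinate `top`, the cocycle pulled back to the Koszul complex is an endomorphism of
    -- `R`, that is, multiplication by `g 1`; this is the required multiplier.
    let g : R →ₗ[R] R := (κ.f r ≫ φ).hom ∘ₗ C.top.symm.toLinearMap
    have hg : ∀ b, g b = g 1 * b := fun b => by
      have := g.map_smul b 1
      rwa [smul_eq_mul, mul_one, smul_eq_mul, mul_comm] at this
    refine ⟨g 1, ?_⟩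
    have hle : (J t).obj ≤ L.obj := (C.antitone hst).trans hL
    have hcomm : (l ≫ κ).f 0 ≫ resAug P = resAug Q.res ≫ quotientMap hle := by
      rw [HomologicalComplex.comp_f, Category.assoc, hκ, ← hl, Category.assoc]
      rfl
    have h1 := hy.restrict hle (l ≫ κ) hcomm
    have h2 : (l ≫ κ).f r ≫ φ = g 1 • μ := by
      refine ModuleCat.hom_ext (LinearMap.ext fun x => ?_)
      have h3 := hg (C.top ((l.f r).hom x))
      have h4 : g (C.top ((l.f r).hom x)) = (κ.f r ≫ φ).hom ((l.f r).hom x) :=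
        congrArg (κ.f r ≫ φ).hom (C.top.symm_apply_apply _)
      exact h4.symm.trans h3
    rw [h2] at h1
    exact h1.unique (hm.smul (g 1))

include hcof in
theorem isGradedQuasiCyclic_of_koszulSystem {r : ℕ} (hJ : ∀ s, (J s).obj.IsHomogeneous 𝒜)
    (C : KoszulSystem 𝒜 r fun s => (J s).obj) :
    IsGradedQuasiCyclic 𝒜 (localCohomologyDegree 𝒜 I r) := by
  have hanti : Antitone fun s => (J s).obj := C.antitone
  choose t hst m hm hcl hgen using exists_homogeneous_generator hJ C
  -- The generator for `σ k` is a class on `J (t (σ k))`, which contains `J (σ (k + 1))`, so it is a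
  -- multiple of the next generator. The `+ 1` makes `σ` strictly increasing, so the chosen indices
  -- remain cofinal.
  let σ : ℕ → ℕ := fun k => Nat.rec 0 (fun _ s => t s + 1) k
  have hσ : ∀ k, σ (k + 1) = t (σ k) + 1 := fun k => rfl
  have hσ' : ∀ k, k ≤ σ k := by
    intro k
    induction k with
    | zero => exact Nat.zero_le _
    | succ k ih =>
      rw [hσ]
      exact Nat.succ_le_succ (ih.trans (hst _))
  have hall : ∀ y : (localCohomology I r).obj (ModuleCat.of R R), ∃ k, ∃ a : R,
      y = a • m (σ k) := by
    intro y
    obtain ⟨L, hL⟩ := exists_isClassOf_eq y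
    obtain ⟨s, hs⟩ := hcof L
    obtain ⟨φ, hφ⟩ := hL (ProjectiveResolution.of _)
    exact ⟨s, hgen (σ s) L ((hanti (hσ' s)).trans hs) _ _ _ hφ⟩
  refine ⟨isGradedModule_localCohomologyDegree hanti hJ hcof fun y => ?_, fun k => m (σ k),
    fun k => hm _, monotone_nat_of_le_succ fun k => ?_, ?_⟩
  · obtain ⟨k, a, h⟩ := hall y
    obtain ⟨e, he⟩ := hm (σ k)
    exact ⟨a, e, _, he, h⟩
  · rw [Submodule.span_singleton_le_iff_mem, Submodule.mem_span_singleton]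
    obtain ⟨P, φ, h⟩ := hcl (σ k)
    obtain ⟨a, ha⟩ := hgen (σ (k + 1)) (J (t (σ k))) (hanti (Nat.le_succ _)) P φ _ h
    exact ⟨a, ha.symm⟩
  · refine Set.eq_univ_of_forall fun y => Set.mem_iUnion.2 ?_
    obtain ⟨k, a, h⟩ := hall y
    exact ⟨k, Submodule.mem_span_singleton.2 ⟨a, h.symm⟩⟩

/-- If `I` is, up to radical, generated by `r` homogeneous elements, then `H^r_I(R)` is graded
quasi-cyclic. -/
theorem isGradedQuasiCyclic_localCohomology {r : ℕ} (f : Fin r → R)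
    (hf : ∀ j, ∃ δ, f j ∈ 𝒜 δ) (hfI : ∀ j, f j ∈ I)
    (hI : I ≤ (Ideal.span (Set.range f)).radical) :
    IsGradedQuasiCyclic 𝒜 (localCohomologyDegree 𝒜 I r) := by
  -- The exponent `s = 0` is harmless: it gives the unit ideal, or the zero ideal when `r = 0`.
  let J : ℕ → SelfLERadical I := fun s => ⟨Ideal.span (Set.range fun j => f j ^ s), by
    refine hI.trans ?_
    rw [Ideal.radical_le_radical_iff, Ideal.span_le]
    rintro _ ⟨j, rfl⟩
    exact ⟨s, Ideal.subset_span ⟨j, rfl⟩⟩⟩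
  obtain ⟨C⟩ := KoszulSystem.nonempty_of_homogeneous f hf
  refine isGradedQuasiCyclic_of_koszulSystem (J := J) (fun L => ?_) (fun s => ?_) C
  · have h : ∀ j, ∃ n, f j ^ n ∈ L.obj := fun j => L.property (hfI j)
    choose n hn using h
    refine ⟨Finset.univ.sup n, Ideal.span_le.2 ?_⟩
    rintro _ ⟨j, rfl⟩
    -- There are finitely many `f j`, so one exponent, the largest of the `n j`, works for all of
    -- them.
    exact L.obj.pow_mem_of_pow_mem (hn j) (Finset.le_sup (Finset.mem_univ j))
  · refine Ideal.homogeneous_span 𝒜 _ ?_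
    rintro _ ⟨j, rfl⟩
    obtain ⟨δ, hδ⟩ := hf j
    exact ⟨_, SetLike.pow_mem_graded s hδ⟩

end Main

/-! ### From hypersurfaces in projective space to the radical condition -/

section Hypersurfaces

variable {K : Type u} [Field K] {n : ℕ}

/-- A proper homogeneous ideal of a polynomial ring over a field is contained in the irrelevant
ideal. -/
lemma isHomogeneous_le_irrelevant {J : Ideal (MvPolynomial (Fin (n + 1)) K)}
    (hJ : J.IsHomogeneous (grading K n)) (hJ' : J ≠ ⊤) :
    J ≤ (HomogeneousIdeal.irrelevant (grading K n)).toIdeal := by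
  intro p hp
  have h : (HomogeneousIdeal.irrelevant (grading K n)).toIdeal =
    RingHom.ker (GradedRing.projZeroRingHom (grading K n)) := rfl
  rw [h, RingHom.mem_ker, GradedRing.projZeroRingHom_apply]
  have h0 := hJ 0 hp
  have hmem := (DirectSum.decompose (grading K n) p 0).2
  rw [MvPolynomial.mem_homogeneousSubmodule] at hmem
  -- The degree zero component lies in `J` and is a constant; if nonzero it would be a unit.
  by_contra hne
  obtain ⟨c, hc⟩ : ∃ c, (DirectSum.decompose (grading K n) p 0 : MvPolynomial (Fin (n + 1)) K) =
      MvPolynomial.C c := ⟨_, MvPolynomial.totalDegree_eq_zero_iff_eq_C.1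
        (Nat.le_zero.1 hmem.totalDegree_le)⟩
  rw [hc] at h0 hne
  have hc0 : c ≠ 0 := fun h => hne (by rw [h, map_zero])
  exact hJ' (J.eq_top_of_isUnit_mem h0 ((isUnit_iff_ne_zero.2 hc0).map MvPolynomial.C))

/-- A weak homogeneous Nullstellensatz, valid for nonempty closed subsets of `ℙ^n`. -/
lemma idealOf_le_radical_span {V : Set (ProjSpace K n)} (hV : V.Nonempty) {ι : Type*}
    {f : ι → MvPolynomial (Fin (n + 1)) K} (hf : ∀ i, ∃ d, f i ∈ grading K n d)
    (hVf : V = ⋂ i, ProjectiveSpectrum.zeroLocus (grading K n) {f i}) :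
    idealOf V ≤ (Ideal.span (Set.range f)).radical := by
  have hhom : (Ideal.span (Set.range f)).IsHomogeneous (grading K n) := by
    refine Ideal.homogeneous_span _ _ ?_
    rintro _ ⟨i, rfl⟩
    exact hf i
  rw [hhom.radical_eq]
  refine le_sInf fun q ⟨hq, hfq, hprime⟩ => ?_
  have hle : ∀ x ∈ V, idealOf V ≤ x.asHomogeneousIdeal.toIdeal := fun x hx p hp =>
    (ProjectiveSpectrum.mem_vanishingIdeal _ _).1 hp x hx
  -- The radical is the intersection of the homogeneous primes `q` containing the `f i`. A relevant
  -- `q` is a point of `V`. Otherwise `q` contains the irrelevant ideal, which contains the prime of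
  -- any point of `V`; this is where a point is needed.
  by_cases hirr : HomogeneousIdeal.irrelevant (grading K n) ≤ ⟨q, hq⟩
  · obtain ⟨x, hx⟩ := hV
    exact (hle x hx).trans ((isHomogeneous_le_irrelevant x.asHomogeneousIdeal.2
      x.isPrime.ne_top).trans hirr)
  · refine hle ⟨⟨q, hq⟩, hprime, hirr⟩ ?_
    rw [hVf, Set.mem_iInter]
    intro i
    exact Set.singleton_subset_iff.2 (hfq (Ideal.subset_span ⟨i, rfl⟩))

/-- The infimum over the empty set is `⊤`, which is not a natural number. -/
lemma IsSetTheoreticCompleteIntersection.nonempty {V : Set (ProjSpace K n)} {r : ℕ}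
    (h : IsSetTheoreticCompleteIntersection V r) : V.Nonempty := by
  rw [Set.nonempty_iff_ne_empty]
  rintro rfl
  have := h.codim_eq
  simp [codim] at this

end Hypersurfaces

end QuasiCyclic

end

theorem mainTheorem4 {K : Type u} [Field K] (n r : ℕ) (V : Set (QuasiCyclic.ProjSpace K n))
    (hV : IsClosed V) (hci : QuasiCyclic.IsSetTheoreticCompleteIntersection V r) :
    QuasiCyclic.IsGradedQuasiCyclic (QuasiCyclic.grading K n)
      (M := (localCohomology (QuasiCyclic.idealOf V) r).obj
        (ModuleCat.of (MvPolynomial (Fin (n + 1)) K) (MvPolynomial (Fin (n + 1)) K)))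
      (QuasiCyclic.localCohomologyDegree (QuasiCyclic.grading K n) (QuasiCyclic.idealOf V) r) := by
  obtain ⟨f, hf, hVf⟩ := hci.exists_hypersurfaces
  have hf' : ∀ i, ∃ d, f i ∈ QuasiCyclic.grading K n d := fun i =>
    (hf i).2.imp fun d hd => (MvPolynomial.mem_homogeneousSubmodule d _).2 hd.2
  refine QuasiCyclic.isGradedQuasiCyclic_localCohomology f hf' (fun i => ?_)
    (QuasiCyclic.idealOf_le_radical_span hci.nonempty hf' hVf)
  refine (ProjectiveSpectrum.mem_vanishingIdeal _ _).2 fun x hx => ?_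
  rw [hVf, Set.mem_iInter] at hx
  exact Set.singleton_subset_iff.1 (hx i)
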